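/- **Setting.** Let $\mathbb N=\{1,2,\dots\}$, let $p_k\in(0,1)$ and $q_k=1-p_k$ for $k\in\mathbb N$, and let $\mathbf X=(X_k)_{k\in\mathbb N}$ be independent random variables on a probability space with $\mathbb P(X_k=1)=p_k$, $\mathbb P(X_k=-1)=q_k$. Put $Y_k=\frac{X_k-p_k+q_k}{2\sqrt{p_kq_k}}$. For sequences write $\langle a,b\rangle=\sum_{k}a_kb_k$. *Gradient.* If $F=\mathfrak f(X_1,X_2,\dots)$, let $F_k^{\pm}=\mathfrak f(X_1,\dots,X_{k-1},\pm1,X_{k+1},\dots)$ and $D_kF=\sqrt{p_kq_k}\,(F_k^+-F_k^-)$. Let $\mathbb D^{1,2}$ be the set of $F\in L^2(\Omega,\sigma\{\mathbf X\},\mathbb P)$ with $\mathbb E\sum_k(D_kF)^2<\infty$. *Divergence.* $\mathrm{Dom}(\delta)$ is the set of $u\in L^2(\Omega,\sigma\{\mathbf X\},\mathbb P;\ell^2(\mathbb N))$ for which there is $C_u>0$ with $|\mathbb E\langle DF,u\rangle|\le C_u\sqrt{\mathbb E[F^2]}$ for all $F\in\mathbb D^{1,2}$; for such $u$, $\delta(u)\in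 L^2(\Omega,\sigma\{\mathbf X\},\mathbb P)$ is determined by $\mathbb E\langle DF,u\rangle=\mathbb E[F\delta(u)]$ for all $F\in\mathbb D^{1,2}$. *Pseudo-inverse of the Ornstein–Uhlenbeck operator.* Every $F\in L^2(\Omega,\sigma\{\mathbf X\},\mathbb P)$ has a unique expansion $F=\mathbb E[F]+\sum_{n\ge1}J_n(f_n)$ in $L^2$, where $f_n\in\ell^2(\mathbb N^n)$ is symmetric and vanishes at tuples with two equal entries, and $J_n(f)=\sum_{i_1,\dots,i_n\text{ distinct}}f(i_1,\dots,i_n)Y_{i_1}\cdots Y_{i_n}$. Set $L^{-1}F=\sum_{n\ge1}-\frac1nJ_n(f_n)$. *Stein solution.* Let $\Phi$ be the standard normal distribution function and, for $z\in\mathbb R$, let $f_z$ be the bounded solution of $f'(x)-xf(x)=\mathbf 1_{\{x\le z\}}-\Phi(z)$, i.e. $f_z(x)=\sqrt{2\pi}\,e^{x^2/2}\,\Phi(x\wedge z)\,(1-\Phi(x\vee z))$. Let $N\sim\mathcal N(0,1)$ and $d_K(F,N)=\sup_{z\in\mathbb R}|\mathbb P(F\le z)-\Phi(z)|$. **Theorem.**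 Let $F\in\mathbb D^{1,2}$ have mean zero and variance one. The random variable $\langle DF,-DL^{-1}F\rangle$ is well defined and integrable, and the following hold. (1) If $$Ff_z(F)+\mathbf 1_{\{F>z\}}\in\mathbb D^{1,2}\quad\text{for all }z\in\mathbb R,\qquad(\ast)$$ then $$d_K(F,N)\le\mathbb E\big[|1-\langle DF,-DL^{-1}F\rangle|\big]+\sup_{z\in\mathbb R}\mathbb E\Big[\Big\langle D\big(Ff_z(F)+\mathbf 1_{\{F>z\}}\big)\frac{DF}{\sqrt{pq}},\,|DL^{-1}F|\Big\rangle\Big],$$ where products, quotients and absolute values of sequences are taken entrywise; the expectations on the right exist and the supremum is finite. (2) If $(\ast)$ holds and $u=(u_k)_{k}\in\mathrm{Dom}(\delta)$, where $u_k=(p_kq_k)^{-1/2}D_kF\,|D_kL^{-1}F|$, then $$d_K(F,N)\le\mathbb E\big[|1-\langle DF,-DL^{-1}F\rangle|\big]+2\,\|\delta(u)\|_{L^1(\Omega)}.$$ (3) Suppose $D_kF\in L^4(\Omega)$ for every $k\in\mathbb N$ (condition $(\ast)$ is not assumed), and either (a) $\sum_{k\in\mathbb N}p_kq_k<\infty$,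 or (b) $F$ depends only on $X_1,\dots,X_m$ for some $m$. Then $$d_K(F,N)\le\mathbb E\big[|1-\langle DF,-DL^{-1}F\rangle|\big]+4\sqrt\kappa\,\Big(\sum_{k\in\mathbb N}\frac1{p_kq_k}\mathbb E\big[(D_kF)^4\big]\Big)^{1/2},$$ where $\kappa=\sum_{k\in\mathbb N}p_kq_k$ in case (a) and $\kappa=\sum_{k=1}^mp_kq_k$ in case (b); the right-hand side may be $+\infty$. -/

import Mathlib

open MeasureTheory ProbabilityTheory Filter Topology
open scoped ENNReal

noncomputable section

/-! ## Kolmogorov distance and the Stein solution -/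

/-- Kolmogorov distance of two laws on the real line:
`sup_z |μ((-∞, z]) - ν((-∞, z])|`. -/
def kolmogorovDist (μ ν : Measure ℝ) : ℝ :=
  ⨆ z : ℝ, |μ.real (Set.Iic z) - ν.real (Set.Iic z)|

/-- The standard normal distribution function. -/
def stdNormalCDF (z : ℝ) : ℝ := cdf (gaussianReal 0 1) z

/-- The (bounded) solution `f_z` of Stein's equation
`f'(x) - x f(x) = 1_{x ≤ z} - Φ(z)`. -/
def steinSol (z x : ℝ) : ℝ :=
  if x ≤ z then
    √(2 * Real.pi) * Real.exp (x ^ 2 / 2) * stdNormalCDF x * (1 - stdNormalCDF z)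
  else
    √(2 * Real.pi) * Real.exp (x ^ 2 / 2) * stdNormalCDF z * (1 - stdNormalCDF x)

namespace Rademacher

variable {Ω : Type*} [MeasurableSpace Ω]

/-- `X` is a sequence of independent Rademacher variables with
`P(X_k = 1) = p_k ∈ (0,1)` and `P(X_k = -1) = 1 - p_k`. -/
structure IsRademacherSeq (P : Measure Ω) (p : ℕ → ℝ) (X : ℕ → Ω → ℝ) : Prop where
  mem_Ioo : ∀ k, p k ∈ Set.Ioo (0 : ℝ) 1
  measurable : ∀ k, Measurable (X k)
  indep : iIndepFun X P
  prob_one : ∀ k, P {ω | X k ω = 1} = ENNReal.ofReal (p k)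
  prob_neg_one : ∀ k, P {ω | X k ω = -1} = ENNReal.ofReal (1 - p k)

/-- The product `p_k q_k`, where `q_k = 1 - p_k`. -/
def pq (p : ℕ → ℝ) (k : ℕ) : ℝ := p k * (1 - p k)

/-- The normalised variables `Y_k = (X_k - p_k + q_k) / (2 √(p_k q_k))`. -/
def normalized (p : ℕ → ℝ) (X : ℕ → Ω → ℝ) (k : ℕ) (ω : Ω) : ℝ :=
  (X k ω - p k + (1 - p k)) / (2 * √(pq p k))

/-- The σ-field `σ{X}` generated by the whole sequence. -/
abbrev sigmaX (X : ℕ → Ω → ℝ) : MeasurableSpace Ω :=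
  MeasurableSpace.comap (fun ω k => X k ω) inferInstance

/-- `F` represents an element of `L²(Ω, σ{X}, P)`. -/
def MemL2 (P : Measure Ω) (X : ℕ → Ω → ℝ) (F : Ω → ℝ) : Prop :=
  MemLp F 2 P ∧ AEStronglyMeasurable[sigmaX X] F P

/-! ## The discrete gradient -/

open Classical in
/-- A measurable `f` with `F = f(X_0, X_1, …)` almost surely; such an `f` exists whenever `F`
is `σ{X}`-measurable up to a null set, and is unique up to null sets of the law of `X`. -/
def representative (P : Measure Ω) (X : ℕ → Ω → ℝ) (F : Ω → ℝ) : (ℕ → ℝ) → ℝ :=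
  if h : ∃ f : (ℕ → ℝ) → ℝ, Measurable f ∧ F =ᵐ[P] fun ω => f (fun k => X k ω)
  then h.choose else 0

/-- `f(X_0, …, X_{k-1}, s, X_{k+1}, …)`, where `F = f(X_0, X_1, …)`. -/
def setCoord (P : Measure Ω) (X : ℕ → Ω → ℝ) (F : Ω → ℝ) (k : ℕ) (s : ℝ) (ω : Ω) : ℝ :=
  representative P X F (Function.update (fun j => X j ω) k s)

/-- The discrete gradient `D_k F = √(p_k q_k) (F_k⁺ - F_k⁻)`. -/
def grad (P : Measure Ω) (p : ℕ → ℝ) (X : ℕ → Ω → ℝ) (F : Ω → ℝ) (k : ℕ) (ω : Ω) : ℝ :=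
  √(pq p k) * (setCoord P X F k 1 ω - setCoord P X F k (-1) ω)

/-- The pairing `⟨a, b⟩ = ∑_k a_k b_k`, pointwise in `ω`. -/
def pairing (a b : ℕ → Ω → ℝ) (ω : Ω) : ℝ := ∑' k, a k ω * b k ω

/-- The series `⟨a, b⟩` converges almost surely and its sum is integrable. -/
def PairingIntegrable (P : Measure Ω) (a b : ℕ → Ω → ℝ) : Prop :=
  (∀ᵐ ω ∂P, Summable fun k => a k ω * b k ω) ∧ Integrable (pairing a b) P

/-- The Sobolev-type space `𝔻^{1,2}`: `F ∈ L²(Ω, σ{X}, P)` with `E[∑_k (D_k F)²] < ∞`. -/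
def MemD12 (P : Measure Ω) (p : ℕ → ℝ) (X : ℕ → Ω → ℝ) (F : Ω → ℝ) : Prop :=
  MemL2 P X F ∧ ∫⁻ ω, ∑' k, ENNReal.ofReal (grad P p X F k ω ^ 2) ∂P < ∞

/-! ## The divergence -/

/-- The space `L²(Ω; ℓ²)` of square-integrable, `σ{X}`-measurable, `ℓ²`-valued variables. -/
def MemL2H (P : Measure Ω) (X : ℕ → Ω → ℝ) (u : ℕ → Ω → ℝ) : Prop :=
  (∀ k, AEStronglyMeasurable[sigmaX X] (u k) P) ∧
    ∫⁻ ω, ∑' k, ENNReal.ofReal (u k ω ^ 2) ∂P < ∞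

/-- The domain of the divergence `δ`: those `u ∈ L²(Ω; ℓ²)` such that
`|E⟨DF, u⟩| ≤ C_u √(E[F²])` for all `F ∈ 𝔻^{1,2}`. -/
def DomDiv (P : Measure Ω) (p : ℕ → ℝ) (X : ℕ → Ω → ℝ) (u : ℕ → Ω → ℝ) : Prop :=
  MemL2H P X u ∧ ∃ C : ℝ, 0 < C ∧ ∀ F : Ω → ℝ, MemD12 P p X F →
    |∫ ω, pairing (grad P p X F) u ω ∂P| ≤ C * √(∫ ω, F ω ^ 2 ∂P)

/-- `d ∈ L²(Ω, σ{X}, P)` satisfies the duality relation `E⟨DF, u⟩ = E[F d]` for all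
`F ∈ 𝔻^{1,2}`. -/
def IsDiv (P : Measure Ω) (p : ℕ → ℝ) (X : ℕ → Ω → ℝ) (u : ℕ → Ω → ℝ) (d : Ω → ℝ) : Prop :=
  MemL2 P X d ∧ ∀ F : Ω → ℝ, MemD12 P p X F →
    ∫ ω, pairing (grad P p X F) u ω ∂P = ∫ ω, F ω * d ω ∂P

open Classical in
/-- The divergence `δ(u)`, the adjoint of `D`, determined (up to null sets) on its domain by
the duality relation. -/
def divergence (P : Measure Ω) (p : ℕ → ℝ) (X : ℕ → Ω → ℝ) (u : ℕ → Ω → ℝ) : Ω → ℝ :=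
  if h : ∃ d : Ω → ℝ, IsDiv P p X u d then h.choose else 0

/-! ## Chaos expansion and the pseudo-inverse of the Ornstein-Uhlenbeck operator -/

open Classical in
/-- The class in `L²(P)` of a square-integrable function. -/
def toL2 (P : Measure Ω) (F : Ω → ℝ) : Lp ℝ 2 P :=
  if h : MemLp F 2 P then h.toLp F else 0

open Classical in
/-- The discrete multiple integral
`J_n(f) = ∑_{i ∈ ℕ^n, i_1, …, i_n distinct} f(i_1, …, i_n) Y_{i_1} ⋯ Y_{i_n}`
(an unconditionally convergent series in `L²(P)` for square-summable `f`). -/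
def multInt (P : Measure Ω) (p : ℕ → ℝ) (X : ℕ → Ω → ℝ) (n : ℕ) (f : (Fin n → ℕ) → ℝ) :
    Lp ℝ 2 P :=
  ∑' i : Fin n → ℕ,
    if Function.Injective i then toL2 P (fun ω => f i * ∏ j, normalized p X (i j) ω) else 0

/-- Square-summable symmetric kernels on `ℕ^n` vanishing off the set of tuples with pairwise
distinct entries. -/
def IsKernel (n : ℕ) (f : (Fin n → ℕ) → ℝ) : Prop :=
  (Summable fun i => f i ^ 2) ∧ (∀ (σ : Equiv.Perm (Fin n)) (i : Fin n → ℕ), f (i ∘ σ) = f i) ∧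
    ∀ i : Fin n → ℕ, ¬ Function.Injective i → f i = 0

/-- `F = E[F] + ∑_{n ≥ 1} J_n(f_n)` in `L²(P)`. -/
def IsChaosExpansion (P : Measure Ω) (p : ℕ → ℝ) (X : ℕ → Ω → ℝ) (F : Ω → ℝ)
    (f : (n : ℕ) → (Fin n → ℕ) → ℝ) : Prop :=
  (∀ n, 1 ≤ n → IsKernel n (f n)) ∧
    HasSum (fun n : ℕ => multInt P p X (n + 1) (f (n + 1)))
      (toL2 P fun ω => F ω - ∫ ω', F ω' ∂P)

open Classical in
/-- The kernels of the chaos expansion of `F ∈ L²(Ω, σ{X}, P)` (unique in each order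
`n ≥ 1`). -/
def chaosKernel (P : Measure Ω) (p : ℕ → ℝ) (X : ℕ → Ω → ℝ) (F : Ω → ℝ) :
    (n : ℕ) → (Fin n → ℕ) → ℝ :=
  if h : ∃ f, IsChaosExpansion P p X F f then h.choose else fun _ _ => 0

/-- The pseudo-inverse of the Ornstein-Uhlenbeck operator,
`L⁻¹ F = ∑_{n ≥ 1} -(1/n) J_n(f_n)`, where `F = E[F] + ∑_{n ≥ 1} J_n(f_n)`. -/
def invOU (P : Measure Ω) (p : ℕ → ℝ) (X : ℕ → Ω → ℝ) (F : Ω → ℝ) : Lp ℝ 2 P :=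
  ∑' n : ℕ, (-(1 / ((n : ℝ) + 1))) • multInt P p X (n + 1) (chaosKernel P p X F (n + 1))

/-! ## The quantities in the bounds -/

/-- `D_k L⁻¹ F`. -/
def gradInvOU (P : Measure Ω) (p : ℕ → ℝ) (X : ℕ → Ω → ℝ) (F : Ω → ℝ) (k : ℕ) (ω : Ω) : ℝ :=
  grad P p X (invOU P p X F : Ω → ℝ) k ω

/-- `F f_z(F) + 1_{F > z}`. -/
def steinFunctional (z : ℝ) (F : Ω → ℝ) (ω : Ω) : ℝ :=
  F ω * steinSol z (F ω) + Set.indicator {ω' | z < F ω'} (fun _ => (1 : ℝ)) ω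

/-- The sequence `D_k(F f_z(F) + 1_{F > z}) · D_k F / √(p_k q_k)`. -/
def steinGradTerm (P : Measure Ω) (p : ℕ → ℝ) (X : ℕ → Ω → ℝ) (F : Ω → ℝ) (z : ℝ)
    (k : ℕ) (ω : Ω) : ℝ :=
  grad P p X (steinFunctional z F) k ω * (grad P p X F k ω / √(pq p k))

/-- The sequence `u_k = (p_k q_k)^{-1/2} D_k F |D_k L⁻¹ F|`. -/
def uSeq (P : Measure Ω) (p : ℕ → ℝ) (X : ℕ → Ω → ℝ) (F : Ω → ℝ) (k : ℕ) (ω : Ω) : ℝ :=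
  (√(pq p k))⁻¹ * grad P p X F k ω * |gradInvOU P p X F k ω|

/-- `E|1 - ⟨DF, -D L⁻¹ F⟩|`. -/
def firstTerm (P : Measure Ω) (p : ℕ → ℝ) (X : ℕ → Ω → ℝ) (F : Ω → ℝ) : ℝ :=
  ∫ ω, |1 - pairing (grad P p X F) (fun k ω' => -gradInvOU P p X F k ω') ω| ∂P

/-- `F` depends (almost surely) only on the first `m` Rademacher variables. -/
def DependsOnFirst (P : Measure Ω) (X : ℕ → Ω → ℝ) (m : ℕ) (F : Ω → ℝ) : Prop :=
  ∃ g : (Fin m → ℝ) → ℝ, Measurable g ∧ F =ᵐ[P] fun ω => g (fun j => X j ω)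

/-- `∑_k (p_k q_k)⁻¹ E[(D_k F)⁴]`, with value `∞` if the series diverges. -/
def fourthMomentSum (P : Measure Ω) (p : ℕ → ℝ) (X : ℕ → Ω → ℝ) (F : Ω → ℝ) : ℝ≥0∞ :=
  ∑' k, ENNReal.ofReal ((pq p k)⁻¹) * ∫⁻ ω, ENNReal.ofReal (grad P p X F k ω ^ 4) ∂P

end Rademacher

end

open Rademacher

noncomputable section

/-! ## The Stein solution -/

section Stein

open Real

/-! The proof combines Stein's method with integration by parts on the Walsh basis. Evaluating
Stein's equation at F gives P(F ≤ z) - Φ(z) = E[f_z'(F)] - E[F f_z(F)], and integration by parts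
(`integral_mul_eq_integral_tsum`) turns the last term into E⟨D f_z(F), -DL⁻¹F⟩. Writing D_k f_z(F) =
f_z'(F) D_kF + R_k and using |f_z'| ≤ 1, the difference is at most E|1 - ⟨DF, -DL⁻¹F⟩| +
E∑|R_k||D_kL⁻¹F|.

The remainder is controlled by monotonicity. By Stein's equation f_z' equals x f_z(x) - 1_{x > z} up
to a constant, a difference of two nondecreasing functions. Its oscillation on an interval is
therefore at most the increment of their sum, x f_z(x) + 1_{x > z} (`steinMono`), and |R_k| ≤ D_k(F
f_z(F) + 1_{F > z}) D_kF / √(p_k q_k) (`ae_abs_discreteGrad_steinSol_sub_le`). That x f_z(x) is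
nondecreasing comes from Mills ratio estimates.

The probabilistic input is that the law of X is invariant under resampling one coordinate. It makes
the products of the Y_k an orthonormal basis of L² indexed by finite sets A; D_k sends the
coefficient at A ∪ {k} to A, and L⁻¹ multiplies the coefficient at A by -1/|A|. Summing 1/|A| over
the |A| elements of A gives 1, which is the integration by parts formula; restricting to sets A
containing k gives E(D_kL⁻¹F)² ≤ E(D_kF)².

Part (1) is the supremum over z. In part (2) the factor 1/√(p_k q_k) is moved into u, and duality
bounds the second term by E|steinMono(F) δ(u)| ≤ 2 E|δ(u)|. For part (3) no divergence is needed: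
`steinMono` has oscillation at most 2, so the second term is at most 2∑E(D_kF)², and Cauchy-Schwarz
with weights p_k q_k brings in the fourth moments. -/

/-- The standard normal density. -/
def stdNormalPDF (x : ℝ) : ℝ := (√(2 * π))⁻¹ * exp (-(x ^ 2) / 2)

lemma stdNormalPDF_eq (x : ℝ) : stdNormalPDF x = gaussianPDFReal 0 1 x := by
  simp [stdNormalPDF, gaussianPDFReal]

lemma stdNormalPDF_pos (x : ℝ) : 0 < stdNormalPDF x := by
  unfold stdNormalPDF; positivity

lemma hasDerivAt_stdNormalPDF (x : ℝ) : HasDerivAt stdNormalPDF (-x * stdNormalPDF x) x := by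
  have h : HasDerivAt (fun x : ℝ => -(x ^ 2) / 2) (-x) x := by
    refine (((hasDerivAt_pow 2 x).neg).div_const 2).congr_deriv ?_
    norm_num
    ring
  have := (h.exp).const_mul ((√(2 * π))⁻¹)
  refine this.congr_deriv ?_
  unfold stdNormalPDF; ring

lemma continuous_stdNormalPDF : Continuous stdNormalPDF :=
  continuous_iff_continuousAt.2 fun x => (hasDerivAt_stdNormalPDF x).continuousAt

lemma stdNormalCDF_eq_integral (x : ℝ) : stdNormalCDF x = ∫ t in Set.Iic x, stdNormalPDF t := by
  rw [stdNormalCDF, cdf_eq_real, measureReal_def, gaussianReal_apply_eq_integral 0 one_ne_zero,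
    ENNReal.toReal_ofReal]
  · simp [stdNormalPDF_eq]
  · exact integral_nonneg fun t => gaussianPDFReal_nonneg 0 1 t

lemma integrable_stdNormalPDF : Integrable stdNormalPDF := by
  have : stdNormalPDF = gaussianPDFReal 0 1 := funext stdNormalPDF_eq
  rw [this]; exact integrable_gaussianPDFReal 0 1

lemma hasDerivAt_stdNormalCDF (x : ℝ) : HasDerivAt stdNormalCDF (stdNormalPDF x) x := by
  have h : stdNormalCDF = fun y => stdNormalCDF 0 + ∫ t in (0 : ℝ)..y, stdNormalPDF t := by
    funext y
    rw [stdNormalCDF_eq_integral, stdNormalCDF_eq_integral,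
      ← intervalIntegral.integral_Iic_sub_Iic integrable_stdNormalPDF.integrableOn
        integrable_stdNormalPDF.integrableOn]
    ring
  rw [h]
  exact (intervalIntegral.integral_hasDerivAt_right (continuous_stdNormalPDF.intervalIntegrable _ _)
    (continuous_stdNormalPDF.stronglyMeasurableAtFilter _ _)
    continuous_stdNormalPDF.continuousAt).const_add _

lemma stdNormalCDF_nonneg (x : ℝ) : 0 ≤ stdNormalCDF x := cdf_nonneg _ x

lemma stdNormalCDF_le_one (x : ℝ) : stdNormalCDF x ≤ 1 := cdf_le_one _ x

lemma tendsto_stdNormalCDF_atBot : Tendsto stdNormalCDF atBot (𝓝 0) := tendsto_cdf_atBot _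

lemma tendsto_stdNormalCDF_atTop : Tendsto stdNormalCDF atTop (𝓝 1) := tendsto_cdf_atTop _

/-- The sum Φ(-y) + Φ(y) has zero derivative and tends to 1 at +∞. -/
lemma stdNormalCDF_neg (x : ℝ) : stdNormalCDF (-x) = 1 - stdNormalCDF x := by
  have hd : ∀ y, HasDerivAt (fun y => stdNormalCDF (-y) + stdNormalCDF y) 0 y := fun y => by
    have h1 : HasDerivAt (fun y => stdNormalCDF (-y)) (stdNormalPDF (-y) * -1) y :=
      (hasDerivAt_stdNormalCDF (-y)).comp y (hasDerivAt_neg y)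
    refine (h1.add (hasDerivAt_stdNormalCDF y)).congr_deriv ?_
    simp [stdNormalPDF]
  have hc : ∀ y, stdNormalCDF (-y) + stdNormalCDF y = stdNormalCDF (-x) + stdNormalCDF x :=
    fun y => is_const_of_deriv_eq_zero (fun y => (hd y).differentiableAt)
      (fun y => (hd y).deriv) y x
  have hl : Tendsto (fun y => stdNormalCDF (-y) + stdNormalCDF y) atTop (𝓝 (0 + 1)) :=
    (tendsto_stdNormalCDF_atBot.comp tendsto_neg_atTop_atBot).add tendsto_stdNormalCDF_atTop
  have := tendsto_nhds_unique hl ((tendsto_congr hc).2 tendsto_const_nhds)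
  linarith

lemma tendsto_exp_neg_sq_atBot : Tendsto (fun x : ℝ => exp (-(x ^ 2) / 2)) atBot (𝓝 0) := by
  refine tendsto_exp_atBot.comp ?_
  have h : Tendsto (fun x : ℝ => x ^ 2 / 2) atBot atTop := by
    refine Tendsto.atTop_div_const (by norm_num) ?_
    have := (tendsto_pow_atTop (α := ℝ) (n := 2) (by norm_num)).comp tendsto_neg_atBot_atTop
    refine this.congr fun x => ?_
    simp
  refine (tendsto_neg_atTop_atBot.comp h).congr fun x => ?_
  simp [neg_div]

lemma tendsto_stdNormalPDF_atBot : Tendsto stdNormalPDF atBot (𝓝 0) := by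
  have := tendsto_exp_neg_sq_atBot.const_mul ((√(2 * π))⁻¹)
  rwa [mul_zero] at this

/-- A function with nonnegative derivative on `(-∞, a)` tending to `0` at `-∞` is nonnegative. -/
lemma nonneg_of_hasDerivAt_nonneg_of_tendsto_atBot {f f' : ℝ → ℝ} {a : ℝ}
    (hf : ∀ x < a, HasDerivAt f (f' x) x) (hf' : ∀ x < a, 0 ≤ f' x)
    (hl : Tendsto f atBot (𝓝 0)) {x : ℝ} (hx : x < a) : 0 ≤ f x := by
  have hm : MonotoneOn f (Set.Iio a) := by
    refine monotoneOn_of_deriv_nonneg (convex_Iio a)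
      (fun y hy => (hf y hy).continuousAt.continuousWithinAt)
      (fun y hy => ?_) (fun y hy => ?_)
    · rw [interior_Iio] at hy
      exact (hf y hy).differentiableAt.differentiableWithinAt
    · rw [interior_Iio] at hy
      rw [(hf y hy).deriv]; exact hf' y hy
  refine le_of_tendsto hl ?_
  filter_upwards [eventually_le_atBot x] with y hy
  exact hm (lt_of_le_of_lt hy hx) hx hy

/-! ### Mills ratio estimates -/

/-- The Mills ratio bounds for the left tail of the standard normal law. -/
lemma stdNormalCDF_mul_ge (x : ℝ) : -stdNormalPDF x ≤ x * stdNormalCDF x := by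
  rcases le_or_gt 0 x with hx | hx
  · have := mul_nonneg hx (stdNormalCDF_nonneg x)
    have := stdNormalPDF_pos x
    linarith
  -- On the negative half-line -φ/x - Φ has derivative φ/x² ≥ 0 and vanishes at -∞. Multiplying by x
  -- < 0 then reverses the inequality.
  · have key : 0 ≤ -stdNormalPDF x / x - stdNormalCDF x := by
      refine nonneg_of_hasDerivAt_nonneg_of_tendsto_atBot
        (f' := fun x => stdNormalPDF x / x ^ 2)
        (f := fun x => -stdNormalPDF x / x - stdNormalCDF x) (a := 0)
        (fun y hy => ?_) (fun y _ => div_nonneg (stdNormalPDF_pos y).le (sq_nonneg y)) ?_ hx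
      · have hy' : y ≠ 0 := hy.ne
        refine (((hasDerivAt_stdNormalPDF y).neg.div (hasDerivAt_id y) hy').sub
          (hasDerivAt_stdNormalCDF y)).congr_deriv ?_
        simp only [id]
        field_simp
        simp
      · have h1 : Tendsto (fun x : ℝ => -stdNormalPDF x / x) atBot (𝓝 0) := by
          have := tendsto_stdNormalPDF_atBot.neg.mul tendsto_inv_atBot_zero
          simpa [div_eq_mul_inv] using this
        simpa using h1.sub tendsto_stdNormalCDF_atBot
    have h2 : x * (-stdNormalPDF x / x - stdNormalCDF x) ≤ 0 :=
      mul_nonpos_of_nonpos_of_nonneg hx.le key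
    have h3 : x * (-stdNormalPDF x / x) = -stdNormalPDF x := mul_div_cancel₀ _ hx.ne
    rw [mul_sub, h3] at h2
    linarith

/-- Up to a positive factor this is the derivative of x Φ(x)/φ(x). Divided by 1 + x² it becomes Φ +
xφ/(1 + x²), which vanishes at -∞ and has derivative 2φ/(1 + x²)². -/
lemma one_add_sq_mul_stdNormalCDF_ge (x : ℝ) :
    0 ≤ (1 + x ^ 2) * stdNormalCDF x + x * stdNormalPDF x := by
  have key : 0 ≤ stdNormalCDF x + x * stdNormalPDF x / (1 + x ^ 2) := by
    refine nonneg_of_hasDerivAt_nonneg_of_tendsto_atBot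
      (f' := fun x => 2 * stdNormalPDF x / (1 + x ^ 2) ^ 2)
      (f := fun x => stdNormalCDF x + x * stdNormalPDF x / (1 + x ^ 2)) (a := x + 1)
      (fun y _ => ?_) (fun y _ => ?_) ?_ (lt_add_one x)
    · have hy : (1 + y ^ 2) ≠ 0 := by positivity
      have hd : HasDerivAt (fun y : ℝ => 1 + y ^ 2) (2 * y) y := by
        simpa using (hasDerivAt_pow 2 y).const_add 1
      refine ((hasDerivAt_stdNormalCDF y).add
        (((hasDerivAt_id y).mul (hasDerivAt_stdNormalPDF y)).div hd hy)).congr_deriv ?_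
      simp only [id, Pi.mul_apply]
      field_simp
      ring
    · have := stdNormalPDF_pos y
      positivity
    · have h1 : Tendsto (fun x : ℝ => x * stdNormalPDF x / (1 + x ^ 2)) atBot (𝓝 0) := by
        refine squeeze_zero_norm (fun y => ?_) tendsto_stdNormalPDF_atBot
        have hp := stdNormalPDF_pos y
        rw [norm_div, norm_mul, Real.norm_eq_abs, Real.norm_eq_abs, Real.norm_eq_abs,
          abs_of_pos hp, abs_of_pos (by positivity : 0 < 1 + y ^ 2), div_le_iff₀ (by positivity)]
        have : |y| ≤ 1 + y ^ 2 := by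
          rw [← sq_abs]; nlinarith [sq_nonneg (|y| - 1)]
        nlinarith
      simpa using tendsto_stdNormalCDF_atBot.add h1
  have := mul_nonneg (by positivity : 0 ≤ 1 + x ^ 2) key
  have h3 : (1 + x ^ 2) * (x * stdNormalPDF x / (1 + x ^ 2)) = x * stdNormalPDF x := by
    field_simp
  rw [mul_add, h3] at this
  exact this

/-- The (left) Mills ratio `Φ / φ` of the standard normal law. -/
def millsRatio (x : ℝ) : ℝ := √(2 * π) * exp (x ^ 2 / 2) * stdNormalCDF x

lemma sqrt_mul_exp_mul_stdNormalPDF (x : ℝ) : √(2 * π) * exp (x ^ 2 / 2) * stdNormalPDF x = 1 := by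
  have h : √(2 * π) ≠ 0 := by positivity
  rw [stdNormalPDF, neg_div, exp_neg]
  field_simp

/-- The ratio solves Stein's equation with constant right-hand side 1, so both branches of f_z are
multiples of it or of its reflection. -/
lemma hasDerivAt_millsRatio (x : ℝ) : HasDerivAt millsRatio (x * millsRatio x + 1) x := by
  have h : HasDerivAt (fun x : ℝ => x ^ 2 / 2) x x := by
    refine ((hasDerivAt_pow 2 x).div_const 2).congr_deriv ?_
    norm_num
  refine ((h.exp.const_mul (√(2 * π))).mul (hasDerivAt_stdNormalCDF x)).congr_deriv ?_
  rw [sqrt_mul_exp_mul_stdNormalPDF, millsRatio]; ring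

lemma neg_one_le_mul_millsRatio (x : ℝ) : -1 ≤ x * millsRatio x := by
  have h := mul_le_mul_of_nonneg_left (stdNormalCDF_mul_ge x)
    (by positivity : 0 ≤ √(2 * π) * exp (x ^ 2 / 2))
  rw [mul_neg, sqrt_mul_exp_mul_stdNormalPDF] at h
  rw [millsRatio]; linarith

lemma monotone_mul_millsRatio : Monotone fun x => x * millsRatio x := by
  have hd : ∀ x, HasDerivAt (fun x => x * millsRatio x)
      (1 * millsRatio x + x * (x * millsRatio x + 1)) x :=
    fun x => (hasDerivAt_id x).mul (hasDerivAt_millsRatio x)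
  refine monotone_of_deriv_nonneg (fun x => (hd x).differentiableAt) fun x => ?_
  rw [(hd x).deriv]
  have h := mul_nonneg (by positivity : 0 ≤ √(2 * π) * exp (x ^ 2 / 2))
    (one_add_sq_mul_stdNormalCDF_ge x)
  have h2 := sqrt_mul_exp_mul_stdNormalPDF x
  have h3 : √(2 * π) * exp (x ^ 2 / 2) * ((1 + x ^ 2) * stdNormalCDF x + x * stdNormalPDF x)
      = (1 + x ^ 2) * millsRatio x + x * (√(2 * π) * exp (x ^ 2 / 2) * stdNormalPDF x) := by
    rw [millsRatio]; ring
  rw [h3, h2] at h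
  linarith

/-! ### Monotonicity and bounds for the Stein solution -/

lemma steinSol_of_le {z x : ℝ} (h : x ≤ z) :
    steinSol z x = millsRatio x * (1 - stdNormalCDF z) := by
  rw [steinSol, if_pos h, millsRatio]

/-- The symmetry of Φ makes the right branch a reflected left branch. The point x = z is allowed
because the branches agree there. -/
lemma steinSol_of_ge {z x : ℝ} (h : z ≤ x) :
    steinSol z x = millsRatio (-x) * stdNormalCDF z := by
  rcases h.eq_or_lt with rfl | h
  · rw [steinSol_of_le le_rfl, millsRatio, millsRatio, stdNormalCDF_neg, neg_sq]; ring
  · rw [steinSol, if_neg h.not_ge, millsRatio, stdNormalCDF_neg, neg_sq]; ring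

lemma mul_steinSol_of_ge {z x : ℝ} (h : z ≤ x) :
    x * steinSol z x = -(-x * millsRatio (-x)) * stdNormalCDF z := by
  rw [steinSol_of_ge h]; ring

/-- On each side of z the function is a nonnegative multiple of x ↦ x M(x) or of its odd reflection,
M being the Mills ratio; the two pieces are glued at z. -/
lemma monotone_mul_steinSol (z : ℝ) : Monotone fun x => x * steinSol z x := by
  have hz0 := stdNormalCDF_nonneg z
  have hz1 := stdNormalCDF_le_one z
  have h1 : ∀ x y, x ≤ y → y ≤ z → x * steinSol z x ≤ y * steinSol z y := fun x y hxy hy => by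
    rw [steinSol_of_le (hxy.trans hy), steinSol_of_le hy, ← mul_assoc, ← mul_assoc]
    exact mul_le_mul_of_nonneg_right (monotone_mul_millsRatio hxy) (by linarith)
  have h2 : ∀ x y, x ≤ y → z ≤ x → x * steinSol z x ≤ y * steinSol z y := fun x y hxy hx => by
    rw [mul_steinSol_of_ge hx, mul_steinSol_of_ge (hx.trans hxy)]
    exact mul_le_mul_of_nonneg_right (neg_le_neg (monotone_mul_millsRatio (neg_le_neg hxy))) hz0
  intro x y hxy
  rcases le_total y z with hy | hy
  · exact h1 x y hxy hy
  · rcases le_total x z with hx | hx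
    · exact (h1 x z hx le_rfl).trans (h2 z y hy le_rfl)
    · exact h2 x y hxy hx

/-- By monotonicity x may be moved right to max x z, where the explicit right branch and -1 ≤ y M(y)
apply. -/
lemma mul_steinSol_le (z x : ℝ) : x * steinSol z x ≤ stdNormalCDF z := by
  refine (monotone_mul_steinSol z (le_max_left x z)).trans ?_
  dsimp only
  rw [mul_steinSol_of_ge (le_max_right x z)]
  nlinarith [neg_one_le_mul_millsRatio (-(max x z)), stdNormalCDF_nonneg z]

lemma le_mul_steinSol (z x : ℝ) : -(1 - stdNormalCDF z) ≤ x * steinSol z x := by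
  refine le_trans ?_ (monotone_mul_steinSol z (min_le_left x z))
  dsimp only
  rw [steinSol_of_le (min_le_right x z), ← mul_assoc]
  nlinarith [neg_one_le_mul_millsRatio (min x z), stdNormalCDF_le_one z]

/-- The derivative of the Stein solution, as prescribed by Stein's equation. -/
def steinDeriv (z x : ℝ) : ℝ :=
  x * steinSol z x + Set.indicator (Set.Iic z) 1 x - stdNormalCDF z

/-- The right derivative of the Stein solution. -/
def steinRightDeriv (z x : ℝ) : ℝ :=
  x * steinSol z x + Set.indicator (Set.Iio z) 1 x - stdNormalCDF z

/-- There is a kink at z, but a one-sided derivative everywhere is enough for the mean value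
inequality. At z it is that of the right branch, hence `Set.Iio` in place of `Set.Iic`. -/
lemma hasDerivWithinAt_steinSol (z x : ℝ) :
    HasDerivWithinAt (steinSol z) (steinRightDeriv z x) (Set.Ici x) x := by
  rcases lt_or_ge x z with h | h
  · have h1 : HasDerivAt (fun x => millsRatio x * (1 - stdNormalCDF z))
        (steinRightDeriv z x) x := by
      refine ((hasDerivAt_millsRatio x).mul_const _).congr_deriv ?_
      rw [steinRightDeriv, steinSol_of_le h.le, Set.indicator_of_mem (Set.mem_Iio.2 h)]
      simp only [Pi.one_apply]; ring
    refine (h1.congr_of_eventuallyEq ?_).hasDerivWithinAt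
    filter_upwards [Iio_mem_nhds h] with y hy
    exact steinSol_of_le (le_of_lt hy)
  · have h1 : HasDerivAt (fun x => millsRatio (-x) * stdNormalCDF z)
        (steinRightDeriv z x) x := by
      have := (hasDerivAt_millsRatio (-x)).comp x (hasDerivAt_neg x)
      refine (this.mul_const _).congr_deriv ?_
      rw [steinRightDeriv, steinSol_of_ge h,
        Set.indicator_of_notMem (by simpa using h)]
      ring
    exact h1.hasDerivWithinAt.congr (fun y hy => steinSol_of_ge (h.trans hy)) (steinSol_of_ge h)

lemma continuous_steinSol (z : ℝ) : Continuous (steinSol z) := by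
  unfold steinSol
  have hc : Continuous stdNormalCDF :=
    continuous_iff_continuousAt.2 fun x => (hasDerivAt_stdNormalCDF x).continuousAt
  refine Continuous.if_le (by fun_prop) (by fun_prop) continuous_id continuous_const ?_
  rintro x rfl
  ring

/-- Since Φ(z) - 1 ≤ x f_z(x) ≤ Φ(z), the derivative lies in [0, 1] for x ≤ z and in [-1, 0] for x >
z. -/
lemma abs_steinDeriv_le_one (z x : ℝ) : |steinDeriv z x| ≤ 1 := by
  have h1 := mul_steinSol_le z x
  have h2 := le_mul_steinSol z x
  have h3 := stdNormalCDF_nonneg z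
  have h4 := stdNormalCDF_le_one z
  rw [steinDeriv, abs_le]
  by_cases h : x ≤ z
  · rw [Set.indicator_of_mem (Set.mem_Iic.2 h)]
    constructor <;> simp only [Pi.one_apply] <;> linarith
  · rw [Set.indicator_of_notMem (by simpa using h)]
    have : stdNormalCDF z - 1 ≤ x * steinSol z x - stdNormalCDF z + 1 := by linarith
    have h5 : 0 ≤ x * steinSol z x ∨ x * steinSol z x < 0 := le_or_gt _ _
    constructor
    · have := monotone_mul_steinSol z (le_of_not_ge h)
      dsimp only at this
      linarith
    · linarith

/-- The nondecreasing function `x f_z(x) + 1_{x > z}`. -/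
def steinMono (z x : ℝ) : ℝ := x * steinSol z x + Set.indicator (Set.Ioi z) 1 x

lemma monotone_indicator_Ioi (z : ℝ) : Monotone (Set.indicator (Set.Ioi z) (1 : ℝ → ℝ)) := by
  intro a b hab
  by_cases ha : z < a
  · rw [Set.indicator_of_mem (Set.mem_Ioi.2 ha),
      Set.indicator_of_mem (Set.mem_Ioi.2 (ha.trans_le hab))]
    rfl
  · rw [Set.indicator_of_notMem (by simpa using ha)]
    exact Set.indicator_nonneg (fun _ _ => zero_le_one) b

lemma monotone_steinMono (z : ℝ) : Monotone (steinMono z) :=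
  (monotone_mul_steinSol z).add (monotone_indicator_Ioi z)

lemma steinMono_le (z x : ℝ) : steinMono z x ≤ 1 + stdNormalCDF z := by
  have h1 := mul_steinSol_le z x
  have h2 : Set.indicator (Set.Ioi z) (1 : ℝ → ℝ) x ≤ 1 :=
    Set.indicator_apply_le' (fun _ => le_rfl) fun _ => zero_le_one
  rw [steinMono]; linarith

lemma le_steinMono (z x : ℝ) : -(1 - stdNormalCDF z) ≤ steinMono z x := by
  have h1 := le_mul_steinSol z x
  have h2 : 0 ≤ Set.indicator (Set.Ioi z) (1 : ℝ → ℝ) x :=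
    Set.indicator_nonneg (fun _ _ => zero_le_one) x
  rw [steinMono]; linarith

lemma abs_steinMono_le (z x : ℝ) : |steinMono z x| ≤ 2 := by
  have := steinMono_le z x
  have := le_steinMono z x
  have := stdNormalCDF_nonneg z
  have := stdNormalCDF_le_one z
  exact abs_le.2 ⟨by linarith, by linarith⟩

/-- All values lie in [Φ(z) - 1, Φ(z) + 1], an interval of length 2. This is better than the 4 that
the uniform bound would give. -/
lemma abs_steinMono_sub_le (z x y : ℝ) : |steinMono z x - steinMono z y| ≤ 2 := by
  have := steinMono_le z x
  have := le_steinMono z x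
  have := steinMono_le z y
  have := le_steinMono z y
  exact abs_le.2 ⟨by linarith, by linarith⟩

/-! ### Increments of the Stein solution -/

lemma steinDeriv_eq (z x : ℝ) : steinDeriv z x =
    x * steinSol z x + 1 - Set.indicator (Set.Ioi z) 1 x - stdNormalCDF z := by
  rw [steinDeriv]
  by_cases h : x ≤ z
  · rw [Set.indicator_of_mem (Set.mem_Iic.2 h), Set.indicator_of_notMem (by simpa using h)]
    simp
  · rw [Set.indicator_of_notMem (by simpa using h),
      Set.indicator_of_mem (Set.mem_Ioi.2 (not_le.1 h))]
    simp

/-- The derivative is, up to a constant, the difference of the monotone functions x f_z(x) and 1_{x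
> z}, so its variation on [a, b] is at most the increment of their sum. Strictness t < b matters: at
t = z the right derivative has already jumped, and only b > z makes the indicator in `steinMono`
jump too. -/
lemma abs_sub_steinRightDeriv_le {z a b t y : ℝ} (hat : a ≤ t) (htb : t < b)
    (hy : y = a ∨ y = b) :
    |steinRightDeriv z t - steinDeriv z y| ≤ steinMono z b - steinMono z a := by
  have h1 := monotone_mul_steinSol z hat
  have h2 := monotone_mul_steinSol z htb.le
  dsimp only at h1 h2
  rw [steinDeriv_eq, steinRightDeriv, steinMono, steinMono, abs_le]
  have hI : ∀ s, Set.indicator (Set.Ioi z) (1 : ℝ → ℝ) s = if z < s then 1 else 0 := fun s => by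
    simp [Set.indicator_apply]
  have hJ : Set.indicator (Set.Iio z) (1 : ℝ → ℝ) t = if t < z then 1 else 0 := by
    simp [Set.indicator_apply]
  simp only [hI, hJ]
  rcases hy with rfl | rfl
  all_goals
    split_ifs <;> constructor <;> linarith

/-- Mean value inequality for t ↦ f_z(t) - f_z'(y) t, whose right derivative is bounded by the
preceding oscillation estimate. -/
lemma abs_steinSol_sub_le {z a b y : ℝ} (hab : a ≤ b) (hy : y = a ∨ y = b) :
    |steinSol z b - steinSol z a - steinDeriv z y * (b - a)| ≤
      (steinMono z b - steinMono z a) * (b - a) := by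
  have h := norm_image_sub_le_of_norm_deriv_right_le_segment (a := a) (b := b)
    (f := fun t => steinSol z t - steinDeriv z y * t)
    (f' := fun t => steinRightDeriv z t - steinDeriv z y * 1)
    (C := steinMono z b - steinMono z a)
    (((continuous_steinSol z).sub (continuous_const.mul continuous_id)).continuousOn)
    (fun t _ => (hasDerivWithinAt_steinSol z t).sub
      ((hasDerivWithinAt_id t _).const_mul (steinDeriv z y)))
    (fun t ht => by
      rw [mul_one]; exact abs_sub_steinRightDeriv_le ht.1 ht.2 hy) b (Set.right_mem_Icc.2 hab)
  rw [Real.norm_eq_abs] at h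
  convert h using 2
  ring

/-- Both factors on the right change sign when a and b are exchanged, so no order is needed. It will
be used with a and b the values F_k^±. -/
lemma abs_steinSol_increment_le (z a b : ℝ) :
    |steinSol z a - steinSol z b - steinDeriv z a * (a - b)| ≤
      (steinMono z a - steinMono z b) * (a - b) := by
  rcases le_total a b with h | h
  · have := abs_steinSol_sub_le (z := z) h (Or.inl rfl)
    rw [← abs_neg]
    calc _ = _ := by congr 1; ring
      _ ≤ _ := this
      _ = _ := by ring
  · exact abs_steinSol_sub_le h (Or.inr rfl)

lemma abs_steinRightDeriv_le_one (z x : ℝ) : |steinRightDeriv z x| ≤ 1 := by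
  rcases eq_or_ne x z with rfl | h
  · have h1 := mul_steinSol_le x x
    have h2 := le_mul_steinSol x x
    have h3 : x * steinSol x x = -(-x * millsRatio (-x)) * stdNormalCDF x :=
      mul_steinSol_of_ge le_rfl
    have h4 := stdNormalCDF_nonneg x
    have h5 := stdNormalCDF_le_one x
    rw [steinRightDeriv, Set.indicator_of_notMem (by simp), abs_le]
    constructor <;> linarith
  · have : steinRightDeriv z x = steinDeriv z x := by
      rw [steinRightDeriv, steinDeriv]
      rcases lt_or_gt_of_ne h with h | h
      · rw [Set.indicator_of_mem (Set.mem_Iio.2 h), Set.indicator_of_mem (Set.mem_Iic.2 h.le)]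
      · rw [Set.indicator_of_notMem (by simpa using h.le),
          Set.indicator_of_notMem (by simpa using h)]
    rw [this]; exact abs_steinDeriv_le_one z x

/-- The Lipschitz constant 1 is what puts f_z(F) in 𝔻^{1,2} along with F. -/
lemma abs_steinSol_sub_steinSol_le (z a b : ℝ) : |steinSol z a - steinSol z b| ≤ |a - b| := by
  wlog hab : b ≤ a generalizing a b
  · rw [abs_sub_comm, abs_sub_comm a]; exact this b a (le_of_not_ge hab)
  have h := norm_image_sub_le_of_norm_deriv_right_le_segment (a := b) (b := a)
    (f := steinSol z) (f' := steinRightDeriv z) (C := 1)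
    (continuous_steinSol z).continuousOn (fun t _ => hasDerivWithinAt_steinSol z t)
    (fun t _ => abs_steinRightDeriv_le_one z t) a (Set.right_mem_Icc.2 hab)
  rw [Real.norm_eq_abs, one_mul] at h
  rwa [abs_of_nonneg (sub_nonneg.2 hab)]

end Stein
end

noncomputable section

namespace Rademacher

/-! ## The law of a Rademacher sequence -/

/-- `μ` is the law on `ℝ^ℕ` of a sequence of independent Rademacher variables: resampling any
coordinate leaves `μ` invariant. -/
structure IsRademacherLaw (μ : Measure (ℕ → ℝ)) (p : ℕ → ℝ) : Prop where
  mem_Ioo : ∀ k, p k ∈ Set.Ioo (0 : ℝ) 1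
  resample : ∀ k, μ = ENNReal.ofReal (p k) • μ.map (fun x => Function.update x k 1) +
    ENNReal.ofReal (1 - p k) • μ.map (fun x => Function.update x k (-1))

/-- The discrete gradient on the sequence space. -/
def discreteGrad (p : ℕ → ℝ) (k : ℕ) (f : (ℕ → ℝ) → ℝ) (x : ℕ → ℝ) : ℝ :=
  √(pq p k) * (f (Function.update x k 1) - f (Function.update x k (-1)))

/-- The normalised coordinates on the sequence space. -/
def coordY (p : ℕ → ℝ) (k : ℕ) (x : ℕ → ℝ) : ℝ := (x k - p k + (1 - p k)) / (2 * √(pq p k))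

/-- The Walsh functions `∏_{k ∈ A} Y_k`. -/
def walsh (p : ℕ → ℝ) (A : Finset ℕ) (x : ℕ → ℝ) : ℝ := ∏ k ∈ A, coordY p k x

/-- The Walsh coefficients. -/
def walshCoef (μ : Measure (ℕ → ℝ)) (p : ℕ → ℝ) (f : (ℕ → ℝ) → ℝ) (A : Finset ℕ) : ℝ :=
  ∫ x, f x * walsh p A x ∂μ

lemma measurable_update_const (k : ℕ) (s : ℝ) :
    Measurable (fun x : ℕ → ℝ => Function.update x k s) :=
  measurable_update_left

lemma measurable_coordY (p : ℕ → ℝ) (k : ℕ) : Measurable (coordY p k) := by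
  unfold coordY; fun_prop

lemma measurable_walsh (p : ℕ → ℝ) (A : Finset ℕ) : Measurable (walsh p A) := by
  unfold walsh
  exact Finset.measurable_fun_prod _ fun k _ => measurable_coordY p k

lemma measurable_discreteGrad (p : ℕ → ℝ) (k : ℕ) {f : (ℕ → ℝ) → ℝ} (hf : Measurable f) :
    Measurable (discreteGrad p k f) :=
  ((hf.comp (measurable_update_const k 1)).sub
    (hf.comp (measurable_update_const k (-1)))).const_mul _

lemma coordY_update_of_ne (p : ℕ → ℝ) {j k : ℕ} (h : j ≠ k) (x : ℕ → ℝ) (s : ℝ) :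
    coordY p j (Function.update x k s) = coordY p j x := by
  simp [coordY, h]

lemma walsh_update_of_notMem (p : ℕ → ℝ) {k : ℕ} {A : Finset ℕ} (h : k ∉ A) (x : ℕ → ℝ) (s : ℝ) :
    walsh p A (Function.update x k s) = walsh p A x :=
  Finset.prod_congr rfl fun _ hj => coordY_update_of_ne p (ne_of_mem_of_not_mem hj h) x s

lemma discreteGrad_update (p : ℕ → ℝ) (k : ℕ) (f : (ℕ → ℝ) → ℝ) (x : ℕ → ℝ) (s : ℝ) :
    discreteGrad p k f (Function.update x k s) = discreteGrad p k f x := by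
  simp [discreteGrad]

lemma walsh_insert (p : ℕ → ℝ) {k : ℕ} {A : Finset ℕ} (h : k ∉ A) (x : ℕ → ℝ) :
    walsh p (insert k A) x = coordY p k x * walsh p A x :=
  Finset.prod_insert h

lemma walsh_empty (p : ℕ → ℝ) (x : ℕ → ℝ) : walsh p ∅ x = 1 := Finset.prod_empty

namespace IsRademacherLaw

variable {μ : Measure (ℕ → ℝ)} {p : ℕ → ℝ}

lemma pq_pos (h : IsRademacherLaw μ p) (k : ℕ) : 0 < pq p k :=
  mul_pos (h.mem_Ioo k).1 (sub_pos.2 (h.mem_Ioo k).2)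

/-- With its companion for -1: averaging Y_k g over the k-th coordinate gives √(p_k q_k)(g_k^+ -
g_k^-) = D_k g. In particular Y_k is centred. -/
lemma coordY_one (h : IsRademacherLaw μ p) (k : ℕ) (x : ℕ → ℝ) :
    p k * coordY p k (Function.update x k 1) = √(pq p k) := by
  have h0 := h.pq_pos k
  have h1 : 0 < √(pq p k) := Real.sqrt_pos.2 h0
  have h2 : √(pq p k) * √(pq p k) = p k * (1 - p k) := Real.mul_self_sqrt h0.le
  simp only [coordY, Function.update_self]
  rw [mul_div_assoc', div_eq_iff (by positivity)]
  linear_combination -2 * h2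

lemma coordY_neg_one (h : IsRademacherLaw μ p) (k : ℕ) (x : ℕ → ℝ) :
    (1 - p k) * coordY p k (Function.update x k (-1)) = -√(pq p k) := by
  have h0 := h.pq_pos k
  have h1 : 0 < √(pq p k) := Real.sqrt_pos.2 h0
  have h2 : √(pq p k) * √(pq p k) = p k * (1 - p k) := Real.mul_self_sqrt h0.le
  simp only [coordY, Function.update_self]
  rw [mul_div_assoc', div_eq_iff (by positivity)]
  linear_combination 2 * h2

lemma coordY_sq_mean (h : IsRademacherLaw μ p) (k : ℕ) (x : ℕ → ℝ) :
    p k * coordY p k (Function.update x k 1) ^ 2 +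
      (1 - p k) * coordY p k (Function.update x k (-1)) ^ 2 = 1 := by
  have e1 := h.coordY_one k x
  have e2 := h.coordY_neg_one k x
  have h1 : 0 < √(pq p k) := Real.sqrt_pos.2 (h.pq_pos k)
  have e3 : √(pq p k) * (coordY p k (Function.update x k 1) -
      coordY p k (Function.update x k (-1))) = 1 := by
    simp only [coordY, Function.update_self]
    field_simp
    ring
  linear_combination coordY p k (Function.update x k 1) * e1 +
    coordY p k (Function.update x k (-1)) * e2 + e3

/-- Each update law, weighted by p_k or q_k, is one of the two summands of μ in the resampling
identity. Hence null sets and integrability pass from F to F_k^±. -/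
lemma map_update_le (h : IsRademacherLaw μ p) (k : ℕ) {s : ℝ} (hs : s = 1 ∨ s = -1) :
    ∃ c : ℝ≥0∞, c ≠ ∞ ∧ μ.map (fun x => Function.update x k s) ≤ c • μ := by
  have key : ∀ (r : ℝ), 0 < r → ∀ ν : Measure (ℕ → ℝ), ENNReal.ofReal r • ν ≤ μ →
      ∃ c : ℝ≥0∞, c ≠ ∞ ∧ ν ≤ c • μ := fun r hr ν hν => by
    have h0 : ENNReal.ofReal r ≠ 0 := (ENNReal.ofReal_pos.2 hr).ne'
    refine ⟨(ENNReal.ofReal r)⁻¹, ENNReal.inv_ne_top.2 h0, ?_⟩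
    calc ν = (ENNReal.ofReal r)⁻¹ • (ENNReal.ofReal r • ν) := by
          rw [smul_smul, ENNReal.inv_mul_cancel h0 ENNReal.ofReal_ne_top, one_smul]
      _ ≤ _ := by gcongr
  have hr := h.resample k
  rcases hs with rfl | rfl
  · refine key (p k) (h.mem_Ioo k).1 _ ?_
    conv_rhs => rw [hr]
    exact Measure.le_add_right le_rfl
  · refine key (1 - p k) (sub_pos.2 (h.mem_Ioo k).2) _ ?_
    conv_rhs => rw [hr]
    exact Measure.le_add_left le_rfl

lemma ae_update (h : IsRademacherLaw μ p) (k : ℕ) {s : ℝ} (hs : s = 1 ∨ s = -1)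
    {Q : (ℕ → ℝ) → Prop} (hQ : ∀ᵐ x ∂μ, Q x) : ∀ᵐ x ∂μ, Q (Function.update x k s) := by
  obtain ⟨c, _, hle⟩ := h.map_update_le k hs
  refine ae_of_ae_map (measurable_update_const k s).aemeasurable ?_
  exact ((Measure.absolutelyContinuous_of_le hle).trans
    Measure.smul_absolutelyContinuous).ae_le hQ

lemma memLp_update (h : IsRademacherLaw μ p) (k : ℕ) {s : ℝ} (hs : s = 1 ∨ s = -1)
    {f : (ℕ → ℝ) → ℝ} {q : ℝ≥0∞} (hf : MemLp f q μ) :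
    MemLp (fun x => f (Function.update x k s)) q μ := by
  obtain ⟨c, hc, hle⟩ := h.map_update_le k hs
  have := hf.of_measure_le_smul hc hle
  exact this.comp_of_map (measurable_update_const k s).aemeasurable

lemma integrable_update (h : IsRademacherLaw μ p) (k : ℕ) {s : ℝ} (hs : s = 1 ∨ s = -1)
    {f : (ℕ → ℝ) → ℝ} (hf : Integrable f μ) :
    Integrable (fun x => f (Function.update x k s)) μ :=
  memLp_one_iff_integrable.1 (h.memLp_update k hs (memLp_one_iff_integrable.2 hf))

lemma integral_resample (h : IsRademacherLaw μ p) (k : ℕ) {f : (ℕ → ℝ) → ℝ}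
    (hf : Integrable f μ) :
    ∫ x, f x ∂μ = ∫ x, (p k * f (Function.update x k 1) +
      (1 - p k) * f (Function.update x k (-1))) ∂μ := by
  have hr := h.resample k
  have hp := h.mem_Ioo k
  obtain ⟨c, hc, hle⟩ := h.map_update_le k (Or.inl rfl)
  obtain ⟨c', hc', hle'⟩ := h.map_update_le k (Or.inr rfl)
  have i1 := hf.of_measure_le_smul hc hle
  have i2 := hf.of_measure_le_smul hc' hle'
  conv_lhs => rw [hr]
  rw [integral_add_measure (i1.smul_measure ENNReal.ofReal_ne_top)
    (i2.smul_measure ENNReal.ofReal_ne_top), integral_smul_measure, integral_smul_measure,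
    integral_map (measurable_update_const k 1).aemeasurable i1.1,
    integral_map (measurable_update_const k (-1)).aemeasurable i2.1,
    ENNReal.toReal_ofReal hp.1.le, ENNReal.toReal_ofReal (sub_pos.2 hp.2).le,
    integral_add ((h.integrable_update k (Or.inl rfl) hf).const_mul _)
      ((h.integrable_update k (Or.inr rfl) hf).const_mul _),
    integral_const_mul, integral_const_mul, smul_eq_mul, smul_eq_mul]

lemma ae_eq_one_or (h : IsRademacherLaw μ p) : ∀ᵐ x ∂μ, ∀ k, x k = 1 ∨ x k = -1 := by
  rw [ae_all_iff]
  intro k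
  have hm : MeasurableSet {x : ℕ → ℝ | x k = 1 ∨ x k = -1} :=
    (measurableSet_eq_fun (measurable_pi_apply k) measurable_const).union
      (measurableSet_eq_fun (measurable_pi_apply k) measurable_const)
  have aux : ∀ s : ℝ, (s = 1 ∨ s = -1) →
      ∀ᵐ x ∂(μ.map fun x => Function.update x k s), x k = 1 ∨ x k = -1 := fun s hs => by
    rw [ae_map_iff (measurable_update_const k s).aemeasurable hm]
    exact Eventually.of_forall fun x => by simpa using hs
  rw [h.resample k, ae_add_measure_iff]
  exact ⟨Measure.ae_smul_measure (aux 1 (Or.inl rfl)) _,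
    Measure.ae_smul_measure (aux (-1) (Or.inr rfl)) _⟩

lemma ae_update_self (h : IsRademacherLaw μ p) : ∀ᵐ x ∂μ, ∀ k,
    Function.update x k 1 = x ∨ Function.update x k (-1) = x := by
  filter_upwards [h.ae_eq_one_or] with x hx k
  rcases hx k with hk | hk
  · left; rw [← hk, Function.update_eq_self]
  · right; rw [← hk, Function.update_eq_self]

lemma ae_abs_coordY_le (h : IsRademacherLaw μ p) (k : ℕ) :
    ∀ᵐ x ∂μ, |coordY p k x| ≤ (√(pq p k))⁻¹ := by
  filter_upwards [h.ae_eq_one_or] with x hx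
  have h1 : 0 < √(pq p k) := Real.sqrt_pos.2 (h.pq_pos k)
  obtain ⟨hp0, hp1⟩ := h.mem_Ioo k
  rw [coordY, abs_div, abs_of_pos (by positivity : 0 < 2 * √(pq p k)), ← one_div,
    div_le_div_iff₀ (by positivity) h1]
  have : |x k - p k + (1 - p k)| ≤ 2 := by
    rcases hx k with hk | hk <;> rw [hk, abs_le] <;> constructor <;> linarith
  nlinarith

lemma ae_abs_walsh_le (h : IsRademacherLaw μ p) (A : Finset ℕ) :
    ∀ᵐ x ∂μ, |walsh p A x| ≤ ∏ k ∈ A, (√(pq p k))⁻¹ := by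
  filter_upwards [ae_all_iff.2 h.ae_abs_coordY_le] with x hx
  rw [walsh, Finset.abs_prod]
  exact Finset.prod_le_prod (fun _ _ => abs_nonneg _) fun k _ => hx k

lemma memLp_discreteGrad (h : IsRademacherLaw μ p) (k : ℕ) {f : (ℕ → ℝ) → ℝ} {q : ℝ≥0∞}
    (hf : MemLp f q μ) : MemLp (discreteGrad p k f) q μ :=
  ((h.memLp_update k (Or.inl rfl) hf).sub (h.memLp_update k (Or.inr rfl) hf)).const_mul _

lemma integral_coordY_mul_eq_zero (h : IsRademacherLaw μ p) {k : ℕ} {f : (ℕ → ℝ) → ℝ}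
    (hf : Integrable (fun x => coordY p k x * f x) μ)
    (hfk : ∀ x s, f (Function.update x k s) = f x) :
    ∫ x, coordY p k x * f x ∂μ = 0 := by
  rw [h.integral_resample k hf, ← integral_zero (ℕ → ℝ) ℝ (μ := μ)]
  refine integral_congr_ae (Eventually.of_forall fun x => ?_)
  dsimp only
  rw [hfk, hfk]
  linear_combination f x * h.coordY_one k x + f x * h.coordY_neg_one k x

/-- Any function on the two points ±1 is affine in Y_k; the coefficients interpolate the values u
and v. -/
lemma ae_indicator_eq (h : IsRademacherLaw μ p) (k : ℕ) (t : Set ℝ) : ∃ a b : ℝ, ∀ᵐ x ∂μ,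
    Set.indicator t (1 : ℝ → ℝ) (x k) = a * coordY p k x + b := by
  have h1 : 0 < √(pq p k) := Real.sqrt_pos.2 (h.pq_pos k)
  set u := Set.indicator t (1 : ℝ → ℝ) 1
  set v := Set.indicator t (1 : ℝ → ℝ) (-1)
  refine ⟨(u - v) * √(pq p k), u - (u - v) * (1 - p k), ?_⟩
  filter_upwards [h.ae_eq_one_or] with x hx
  rcases hx k with hk | hk <;> rw [coordY, hk] <;> field_simp
  · change u * 2 = _; ring
  · change v * 2 = _; ring

/-! ### The Walsh orthonormal system -/

section Prob

variable [IsProbabilityMeasure μ]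

lemma memLp_walsh (h : IsRademacherLaw μ p) (A : Finset ℕ) (q : ℝ≥0∞) :
    MemLp (walsh p A) q μ :=
  MemLp.of_bound (measurable_walsh p A).aestronglyMeasurable _ (h.ae_abs_walsh_le A)

lemma integrable_mul_walsh (h : IsRademacherLaw μ p) {f : (ℕ → ℝ) → ℝ} (hf : MemLp f 2 μ)
    (A : Finset ℕ) : Integrable (fun x => f x * walsh p A x) μ :=
  hf.integrable_mul (h.memLp_walsh A 2)

/-- Averaging f Y_k over the k-th coordinate produces D_k f, while the other factors of the Walsh
function are unaffected. -/
lemma walshCoef_discreteGrad_of_notMem (h : IsRademacherLaw μ p) {k : ℕ} {f : (ℕ → ℝ) → ℝ}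
    (hf : MemLp f 2 μ) {A : Finset ℕ} (hk : k ∉ A) :
    walshCoef μ p (discreteGrad p k f) A = walshCoef μ p f (insert k A) := by
  rw [walshCoef, walshCoef, h.integral_resample k (h.integrable_mul_walsh hf _)]
  refine integral_congr_ae (Eventually.of_forall fun x => ?_)
  dsimp only
  rw [walsh_insert p hk, walsh_insert p hk, walsh_update_of_notMem p hk,
    walsh_update_of_notMem p hk, discreteGrad]
  linear_combination -(f (Function.update x k 1)) * walsh p A x * h.coordY_one k x -
    f (Function.update x k (-1)) * walsh p A x * h.coordY_neg_one k x

/-- D_k f does not depend on the k-th coordinate, so the centred factor Y_k integrates to zero. -/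
lemma walshCoef_discreteGrad_of_mem (h : IsRademacherLaw μ p) {k : ℕ} {f : (ℕ → ℝ) → ℝ}
    (hf : MemLp f 2 μ) {A : Finset ℕ} (hk : k ∈ A) :
    walshCoef μ p (discreteGrad p k f) A = 0 := by
  have e : ∀ x, discreteGrad p k f x * walsh p A x =
      coordY p k x * (discreteGrad p k f x * walsh p (A.erase k) x) := fun x => by
    rw [← Finset.insert_erase hk, walsh_insert p (Finset.notMem_erase k A)]
    simp only [Finset.erase_insert_eq_erase, Finset.erase_idem]; ring
  have i := h.integrable_mul_walsh (h.memLp_discreteGrad k hf) A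
  simp only [e] at i
  simp only [walshCoef, e]
  refine h.integral_coordY_mul_eq_zero i fun x s => ?_
  rw [discreteGrad_update, walsh_update_of_notMem p (Finset.notMem_erase k A)]

lemma integral_walsh_mul_walsh_self (h : IsRademacherLaw μ p) (A : Finset ℕ) :
    ∫ x, walsh p A x * walsh p A x ∂μ = 1 := by
  induction A using Finset.induction_on with
  | empty => simp [walsh_empty]
  | insert k A hk ih =>
    rw [h.integral_resample k (h.integrable_mul_walsh (h.memLp_walsh _ 2) _)]
    refine Eq.trans ?_ ih
    refine integral_congr_ae (Eventually.of_forall fun x => ?_)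
    dsimp only
    simp only [walsh_insert p hk, walsh_update_of_notMem p hk]
    linear_combination walsh p A x * walsh p A x * h.coordY_sq_mean k x

lemma integral_walsh_mul_walsh_of_ne (h : IsRademacherLaw μ p) {A B : Finset ℕ} (hAB : A ≠ B) :
    ∫ x, walsh p A x * walsh p B x ∂μ = 0 := by
  have key : ∀ A B : Finset ℕ, ∀ k ∈ A, k ∉ B → ∫ x, walsh p A x * walsh p B x ∂μ = 0 :=
    fun A B k hA hB => by
    have e : ∀ x, walsh p A x * walsh p B x =
        coordY p k x * (walsh p (A.erase k) x * walsh p B x) := fun x => by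
      conv_lhs => rw [← Finset.insert_erase hA, walsh_insert p (Finset.notMem_erase k A)]
      ring
    have i := h.integrable_mul_walsh (h.memLp_walsh A 2) B
    simp only [e] at i ⊢
    refine h.integral_coordY_mul_eq_zero i fun x s => ?_
    rw [walsh_update_of_notMem p (Finset.notMem_erase k A), walsh_update_of_notMem p hB]
  by_cases h1 : A ⊆ B
  · obtain ⟨k, hB, hA⟩ := Finset.not_subset.1 fun h2 => hAB (h1.antisymm h2)
    simp only [mul_comm (walsh p A _)]
    exact key B A k hB hA
  · obtain ⟨k, hA, hB⟩ := Finset.not_subset.1 h1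
    exact key A B k hA hB

/-! ### Completeness of the Walsh system -/

/-- The indicator of a finite box is almost everywhere a product of affine functions of the Y_k, and
expands into finitely many Walsh functions. -/
lemma setIntegral_box_eq_zero (h : IsRademacherLaw μ p) {f : (ℕ → ℝ) → ℝ} (hf : MemLp f 2 μ)
    (h0 : ∀ A, walshCoef μ p f A = 0) (s : Finset ℕ) (t : ℕ → Set ℝ)
    (ht : ∀ k, MeasurableSet (t k)) : ∫ x in (s : Set ℕ).pi t, f x ∂μ = 0 := by
  choose a b hab using fun k => h.ae_indicator_eq k (t k)
  have hm : MeasurableSet ((s : Set ℕ).pi t) :=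
    MeasurableSet.pi s.countable_toSet fun k _ => ht k
  have e : ∀ᵐ x ∂μ, ((s : Set ℕ).pi t).indicator f x =
      ∑ A ∈ s.powerset, ((∏ k ∈ A, a k) * ∏ k ∈ s \ A, b k) * (f x * walsh p A x) := by
    filter_upwards [ae_all_iff.2 hab] with x hx
    have e1 : ((s : Set ℕ).pi t).indicator f x =
        f x * ∏ k ∈ s, Set.indicator (t k) (1 : ℝ → ℝ) (x k) := by
      by_cases hxs : x ∈ (s : Set ℕ).pi t
      · rw [Set.indicator_of_mem hxs, Finset.prod_eq_one, mul_one]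
        intro k hk
        rw [Set.indicator_of_mem (hxs k hk)]; rfl
      · rw [Set.indicator_of_notMem hxs]
        simp only [Set.mem_pi, not_forall] at hxs
        obtain ⟨k, hk, hkt⟩ := hxs
        rw [Finset.prod_eq_zero hk (Set.indicator_of_notMem hkt _), mul_zero]
    rw [e1, Finset.prod_congr rfl fun k _ => hx k, Finset.prod_add, Finset.mul_sum]
    refine Finset.sum_congr rfl fun A _ => ?_
    rw [Finset.prod_mul_distrib, walsh]; ring
  rw [← integral_indicator hm, integral_congr_ae e, integral_finsetSum]
  · refine Finset.sum_eq_zero fun A _ => ?_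
    rw [integral_const_mul]
    have := h0 A
    rw [walshCoef] at this
    rw [this, mul_zero]
  · exact fun A _ => (h.integrable_mul_walsh hf A).const_mul _

lemma ae_eq_zero_of_walshCoef_eq_zero (h : IsRademacherLaw μ p) {f : (ℕ → ℝ) → ℝ}
    (hf : MemLp f 2 μ) (h0 : ∀ A, walshCoef μ p f A = 0) : f =ᵐ[μ] 0 := by
  have hi : Integrable f μ := hf.integrable (by norm_num)
  refine hi.ae_eq_zero_of_forall_setIntegral_eq_zero fun s hs _ => ?_
  induction s, hs using MeasurableSpace.induction_on_inter
    (generateFrom_squareCylinders (α := fun _ : ℕ => ℝ)).symm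
    (isPiSystem_squareCylinders (fun _ => MeasurableSpace.isPiSystem_measurableSet) (by simp)) with
  | empty => simp
  | basic s hs =>
    obtain ⟨s, t, ht, rfl⟩ := hs
    exact h.setIntegral_box_eq_zero hf h0 s t fun k => ht k (Set.mem_univ k)
  | compl s hs ih =>
    have := integral_add_compl hs hi
    -- The coefficient at ∅ is the total integral.
    have h1 : ∫ x, f x ∂μ = 0 := by
      have := h0 ∅
      simpa [walshCoef, walsh_empty] using this
    rw [ih (measure_lt_top _ _), h1, zero_add] at this
    exact this
  | iUnion s hd hm ih =>
    rw [integral_iUnion hm hd hi.integrableOn]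
    simp [ih, measure_lt_top]

/-- The Walsh functions as elements of `L²`. -/
def walshLp (h : IsRademacherLaw μ p) (A : Finset ℕ) : Lp ℝ 2 μ := (h.memLp_walsh A 2).toLp

lemma inner_toLp_walshLp (h : IsRademacherLaw μ p) {f : (ℕ → ℝ) → ℝ} (hf : MemLp f 2 μ)
    (A : Finset ℕ) : inner ℝ (hf.toLp) (h.walshLp A) = walshCoef μ p f A := by
  rw [L2.inner_def, walshCoef]
  refine integral_congr_ae ?_
  filter_upwards [hf.coeFn_toLp, (h.memLp_walsh A 2).coeFn_toLp] with x hx hy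
  rw [walshLp, hx, hy]; simp [mul_comm]

lemma orthonormal_walshLp (h : IsRademacherLaw μ p) : Orthonormal ℝ h.walshLp := by
  classical
  rw [orthonormal_iff_ite]
  intro A B
  rw [walshLp, inner_toLp_walshLp, walshCoef]
  split_ifs with hAB
  · rw [hAB]; exact h.integral_walsh_mul_walsh_self B
  · exact h.integral_walsh_mul_walsh_of_ne hAB

/-- The Walsh functions form a Hilbert basis of `L²`. -/
def walshBasis (h : IsRademacherLaw μ p) : HilbertBasis (Finset ℕ) ℝ (Lp ℝ 2 μ) :=
  HilbertBasis.mkOfOrthogonalEqBot h.orthonormal_walshLp (by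
    rw [Submodule.eq_bot_iff]
    intro g hg
    rw [Submodule.mem_orthogonal'] at hg
    have hm := Lp.memLp g
    have : (g : (ℕ → ℝ) → ℝ) =ᵐ[μ] 0 := by
      refine h.ae_eq_zero_of_walshCoef_eq_zero hm fun A => ?_
      rw [← h.inner_toLp_walshLp hm, Lp.toLp_coeFn]
      exact hg _ (Submodule.subset_span ⟨A, rfl⟩)
    exact (Lp.eq_zero_iff_ae_eq_zero).2 this)

lemma coe_walshBasis (h : IsRademacherLaw μ p) : ⇑h.walshBasis = h.walshLp :=
  HilbertBasis.coe_mkOfOrthogonalEqBot _ _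

lemma hasSum_walshCoef_mul (h : IsRademacherLaw μ p) {f g : (ℕ → ℝ) → ℝ} (hf : MemLp f 2 μ)
    (hg : MemLp g 2 μ) :
    HasSum (fun A => walshCoef μ p f A * walshCoef μ p g A) (∫ x, f x * g x ∂μ) := by
  have := h.walshBasis.hasSum_inner_mul_inner hf.toLp hg.toLp
  simp only [coe_walshBasis] at this
  have e : inner ℝ hf.toLp hg.toLp = ∫ x, f x * g x ∂μ := by
    rw [L2.inner_def]
    refine integral_congr_ae ?_
    filter_upwards [hf.coeFn_toLp, hg.coeFn_toLp] with x hx hy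
    rw [hx, hy]; simp [mul_comm]
  rw [e] at this
  refine this.congr_fun fun A => ?_
  rw [h.inner_toLp_walshLp, real_inner_comm, h.inner_toLp_walshLp]

end Prob

end IsRademacherLaw

end Rademacher
end

noncomputable section

namespace Rademacher

/-! ## Integration by parts -/

/-- A series of integrable functions with summable `L¹` norms converges almost everywhere to an
integrable function. -/
lemma ae_summable_and_integrable_tsum {α : Type*} [MeasurableSpace α] {ν : Measure α}
    {u : ℕ → α → ℝ} (hu : ∀ k, Integrable (u k) ν)
    (hs : Summable fun k => ∫ x, |u k x| ∂ν) :
    (∀ᵐ x ∂ν, Summable fun k => u k x) ∧ Integrable (fun x => ∑' k, u k x) ν := by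
  have hfin : ∫⁻ x, ∑' k, ‖u k x‖ₑ ∂ν ≠ ∞ := by
    rw [lintegral_tsum fun k => (hu k).1.enorm]
    have e : ∀ k, ∫⁻ x, ‖u k x‖ₑ ∂ν = ENNReal.ofReal (∫ x, |u k x| ∂ν) := fun k => by
      rw [ofReal_integral_eq_lintegral_ofReal (hu k).abs
        (Eventually.of_forall fun _ => abs_nonneg _)]
      simp [Real.enorm_eq_ofReal_abs]
    simp only [e]
    exact hs.tsum_ofReal_ne_top
  have hsum : ∀ᵐ x ∂ν, Summable fun k => ‖u k x‖ := by
    filter_upwards [ae_lt_top' (AEMeasurable.tsum fun k => (hu k).1.enorm) hfin] with x hx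
    have h1 : ∑' k, ((‖u k x‖₊ : NNReal) : ℝ≥0∞) ≠ ∞ := hx.ne
    have := ENNReal.tsum_coe_ne_top_iff_summable.1 h1
    exact NNReal.summable_coe.2 this
  refine ⟨hsum.mono fun x hx => hx.of_norm, ?_, ?_⟩
  · refine aestronglyMeasurable_of_tendsto_ae atTop
      (f := fun n x => ∑ k ∈ Finset.range n, u k x) (fun n => ?_) ?_
    · exact Finset.aestronglyMeasurable_fun_sum _ fun k _ => (hu k).1
    · filter_upwards [hsum] with x hx
      exact hx.of_norm.hasSum.tendsto_sum_nat
  · refine lt_of_le_of_lt (lintegral_mono_ae ?_) hfin.lt_top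
    filter_upwards [hsum] with x hx
    have h1 : ‖∑' k, u k x‖ ≤ ∑' k, ‖u k x‖ := norm_tsum_le_tsum_norm hx
    rw [← ofReal_norm]
    refine (ENNReal.ofReal_le_ofReal h1).trans ?_
    rw [ENNReal.ofReal_tsum_of_nonneg (fun _ => norm_nonneg _) hx]
    exact (tsum_congr fun k => ofReal_norm (u k x)).le

lemma integral_abs_mul_le {α : Type*} [MeasurableSpace α] {ν : Measure α} {f g : α → ℝ}
    (hf : MemLp f 2 ν) (hg : MemLp g 2 ν) :
    ∫ x, |f x * g x| ∂ν ≤ ((∫ x, f x ^ 2 ∂ν) + ∫ x, g x ^ 2 ∂ν) / 2 := by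
  rw [← integral_add hf.integrable_sq hg.integrable_sq, ← integral_div]
  refine integral_mono (hf.integrable_mul hg).abs
    ((hf.integrable_sq.add hg.integrable_sq).div_const 2) fun x => ?_
  dsimp only
  rw [abs_mul, ← sq_abs (f x), ← sq_abs (g x)]
  nlinarith [sq_nonneg (|f x| - |g x|)]

lemma summable_integral_abs_mul {α : Type*} [MeasurableSpace α] {ν : Measure α}
    {f g : ℕ → α → ℝ} (hf : ∀ k, MemLp (f k) 2 ν) (hg : ∀ k, MemLp (g k) 2 ν)
    (hfs : Summable fun k => ∫ x, f k x ^ 2 ∂ν) (hgs : Summable fun k => ∫ x, g k x ^ 2 ∂ν) :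
    Summable fun k => ∫ x, |f k x * g k x| ∂ν :=
  Summable.of_nonneg_of_le (fun _ => integral_nonneg fun _ => abs_nonneg _)
    (fun k => integral_abs_mul_le (hf k) (hg k)) ((hfs.add hgs).div_const 2)

/-- The involution of finite sets toggling the membership of `k`. -/
def toggle (k : ℕ) : Finset ℕ ≃ Finset ℕ :=
  (show Function.Involutive fun A : Finset ℕ => if k ∈ A then A.erase k else insert k A by
    intro A
    by_cases h : k ∈ A <;> simp [h, Finset.insert_erase]).toPerm

lemma toggle_of_mem {k : ℕ} {A : Finset ℕ} (h : k ∈ A) : toggle k A = A.erase k := if_pos h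

lemma toggle_of_notMem {k : ℕ} {A : Finset ℕ} (h : k ∉ A) : toggle k A = insert k A := if_neg h

namespace IsRademacherLaw

variable {μ : Measure (ℕ → ℝ)} {p : ℕ → ℝ} [IsProbabilityMeasure μ]

open Classical in
lemma hasSum_integral_discreteGrad_mul (h : IsRademacherLaw μ p) {f g : (ℕ → ℝ) → ℝ}
    (hf : MemLp f 2 μ) (hg : MemLp g 2 μ) (k : ℕ) :
    HasSum (fun A => if k ∈ A then walshCoef μ p f A * walshCoef μ p g A else 0)
      (∫ x, discreteGrad p k f x * discreteGrad p k g x ∂μ) := by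
  have h1 := h.hasSum_walshCoef_mul (h.memLp_discreteGrad k hf) (h.memLp_discreteGrad k hg)
  -- D_k shifts coefficients from A ∪ {k} to A, so Parseval for D_k f and D_k g is reindexed by
  -- toggling k.
  rw [← (toggle k).hasSum_iff]
  refine h1.congr_fun fun A => ?_
  by_cases hk : k ∈ A
  · rw [h.walshCoef_discreteGrad_of_mem hf hk, Function.comp_apply, toggle_of_mem hk,
      if_neg (Finset.notMem_erase k A), zero_mul]
  · rw [h.walshCoef_discreteGrad_of_notMem hf hk, h.walshCoef_discreteGrad_of_notMem hg hk,
      Function.comp_apply, toggle_of_notMem hk, if_pos (Finset.mem_insert_self k A)]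

/-- Only sets A containing k contribute, and for them |A| ≥ 1, so dividing by |A| decreases every
term. -/
lemma integral_discreteGrad_sq_le (h : IsRademacherLaw μ p) {f L : (ℕ → ℝ) → ℝ}
    (hf : MemLp f 2 μ) (hL : MemLp L 2 μ)
    (hfL : ∀ A : Finset ℕ, walshCoef μ p L A = -(walshCoef μ p f A / A.card)) (k : ℕ) :
    ∫ x, discreteGrad p k L x ^ 2 ∂μ ≤ ∫ x, discreteGrad p k f x ^ 2 ∂μ := by
  simp only [sq]
  refine hasSum_le (fun A => ?_) (h.hasSum_integral_discreteGrad_mul hL hL k)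
    (h.hasSum_integral_discreteGrad_mul hf hf k)
  split_ifs with hk
  · have hc : (1 : ℝ) ≤ A.card := by exact_mod_cast Finset.card_pos.2 ⟨k, hk⟩
    rw [hfL, neg_mul_neg, div_mul_div_comm]
    exact div_le_self (mul_self_nonneg _) (one_le_mul_of_one_le_of_one_le hc hc)
  · exact le_rfl

lemma summable_integral_discreteGrad_sq (h : IsRademacherLaw μ p) {f L : (ℕ → ℝ) → ℝ}
    (hf : MemLp f 2 μ) (hL : MemLp L 2 μ)
    (hfL : ∀ A : Finset ℕ, walshCoef μ p L A = -(walshCoef μ p f A / A.card))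
    (hs : Summable fun k => ∫ x, discreteGrad p k f x ^ 2 ∂μ) :
    Summable fun k => ∫ x, discreteGrad p k L x ^ 2 ∂μ :=
  Summable.of_nonneg_of_le (fun _ => integral_nonneg fun _ => sq_nonneg _)
    (h.integral_discreteGrad_sq_le hf hL hfL) hs

/-- The integration by parts formula `E[f g] = E⟨Dg, -D L⁻¹ f⟩`. -/
lemma integral_mul_eq_integral_tsum (h : IsRademacherLaw μ p) {f g L : (ℕ → ℝ) → ℝ}
    (hf : MemLp f 2 μ) (hg : MemLp g 2 μ) (hL : MemLp L 2 μ)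
    (hfL : ∀ A : Finset ℕ, walshCoef μ p L A = -(walshCoef μ p f A / A.card))
    (hfs : Summable fun k => ∫ x, discreteGrad p k f x ^ 2 ∂μ)
    (hgs : Summable fun k => ∫ x, discreteGrad p k g x ^ 2 ∂μ)
    (h0 : ∫ x, f x ∂μ = 0) :
    ∫ x, f x * g x ∂μ = ∫ x, ∑' k, discreteGrad p k g x * -discreteGrad p k L x ∂μ := by
  classical
  have hLs := h.summable_integral_discreteGrad_sq hf hL hfL hfs
  have mg := fun k => h.memLp_discreteGrad k hg
  have mL := fun k => h.memLp_discreteGrad k hL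
  have hi : ∀ k, Integrable (fun x => discreteGrad p k g x * -discreteGrad p k L x) μ :=
    fun k => (mg k).integrable_mul (mL k).neg
  have hsum : Summable fun k => ∫ x, ‖discreteGrad p k g x * -discreteGrad p k L x‖ ∂μ := by
    simpa using summable_integral_abs_mul mg mL hgs hLs
  rw [← integral_tsum_of_summable_integral_norm hi hsum]
  set φ : Finset ℕ → ℝ := fun A => walshCoef μ p f A * walshCoef μ p g A
  have hφ : HasSum φ (∫ x, f x * g x ∂μ) := h.hasSum_walshCoef_mul hf hg
  -- The empty set has no element over which its mass could be spread; this is where mean zero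
  -- enters.
  have hφ0 : φ ∅ = 0 := by
    have : walshCoef μ p f ∅ = 0 := by simpa [walshCoef, walsh_empty] using h0
    simp [φ, this]
  -- The mass φ A is shared equally among the elements of A: summing over k returns φ A, summing
  -- over A gives the k-th term of the pairing.
  set ψ : Finset ℕ → ℕ → ℝ := fun A k => if k ∈ A then φ A / A.card else 0
  have hk : ∀ k, HasSum (fun A => ψ A k)
      (∫ x, discreteGrad p k g x * -discreteGrad p k L x ∂μ) := fun k => by
    have h1 := (h.hasSum_integral_discreteGrad_mul hg hL k).neg
    simp only [← integral_neg, ← mul_neg] at h1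
    refine h1.congr_fun fun A => ?_
    simp only [ψ, φ]
    split_ifs
    · rw [hfL]; ring
    · rw [neg_zero]
  have hA : ∀ (θ : Finset ℕ → ℝ), θ ∅ = 0 → ∀ A : Finset ℕ,
      HasSum (fun k => if k ∈ A then θ A / A.card else 0) (θ A) := fun θ hθ A => by
    have h1 : HasSum (fun k => if k ∈ A then θ A / A.card else 0)
        (∑ k ∈ A, if k ∈ A then θ A / A.card else 0) :=
      hasSum_sum_of_ne_finset_zero fun k hk => if_neg hk
    convert h1 using 1
    rw [Finset.sum_congr rfl fun k hk => if_pos hk, Finset.sum_const, nsmul_eq_mul]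
    rcases A.eq_empty_or_nonempty with rfl | hne
    · simp [hθ]
    · have : (A.card : ℝ) ≠ 0 := by exact_mod_cast hne.card_pos.ne'
      field_simp
  -- The same sharing applied to |φ A| gives absolute summability, which justifies exchanging the
  -- sums.
  have hprod : Summable (Function.uncurry ψ) := by
    rw [← summable_norm_iff]
    have hn : ∀ A k, ‖ψ A k‖ = if k ∈ A then |φ A| / A.card else 0 := fun A k => by
      simp only [ψ]; split_ifs <;> simp
    have hA' := hA (fun A => |φ A|) (by simp [hφ0])
    refine (summable_prod_of_nonneg fun _ => norm_nonneg _).2 ⟨fun A => ?_, ?_⟩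
    · simp only [Function.uncurry_apply_pair, hn]
      exact (hA' A).summable
    · simp only [Function.uncurry_apply_pair, hn, (hA' _).tsum_eq]
      exact hφ.summable.abs
  rw [← hφ.tsum_eq, tsum_congr fun A => (hA φ hφ0 A).tsum_eq.symm, (Summable.tsum_comm (f := ψ) hprod).symm]
  exact tsum_congr fun k => (hk k).tsum_eq

end IsRademacherLaw
end Rademacher
end

noncomputable section

namespace Rademacher

namespace IsRademacherLaw

/-! ## The Kolmogorov bound on the sequence space -/

variable {μ : Measure (ℕ → ℝ)} {p : ℕ → ℝ}

lemma measurable_steinSol (z : ℝ) : Measurable (steinSol z) := (continuous_steinSol z).measurable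

lemma measurable_steinMono (z : ℝ) : Measurable (steinMono z) := (monotone_steinMono z).measurable

lemma measurable_steinDeriv (z : ℝ) : Measurable (steinDeriv z) :=
  ((measurable_id.mul (measurable_steinSol z)).add
    (measurable_one.indicator measurableSet_Iic)).sub_const _

/-- Approximate chain rule for D_k. Almost surely f(x) is one of the two values a, b obtained by
resetting coordinate k, so the increment estimate applies with base point f(x). -/
lemma ae_abs_discreteGrad_steinSol_sub_le (h : IsRademacherLaw μ p) (f : (ℕ → ℝ) → ℝ) (z : ℝ) :
    ∀ᵐ x ∂μ, ∀ k, |discreteGrad p k (fun y => steinSol z (f y)) x -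
        steinDeriv z (f x) * discreteGrad p k f x| ≤
      discreteGrad p k (fun y => steinMono z (f y)) x * (discreteGrad p k f x / √(pq p k)) := by
  filter_upwards [h.ae_update_self] with x hx k
  have h1 : 0 < √(pq p k) := Real.sqrt_pos.2 (h.pq_pos k)
  simp only [discreteGrad]
  set a := f (Function.update x k 1)
  set b := f (Function.update x k (-1))
  have key : |steinSol z a - steinSol z b - steinDeriv z (f x) * (a - b)| ≤
      (steinMono z a - steinMono z b) * (a - b) := by
    rcases hx k with e | e
    · have : f x = a := by simp only [a, e]
      rw [this]
      exact abs_steinSol_increment_le z a b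
    · have : f x = b := by simp only [b, e]
      rw [this, ← abs_neg]
      calc _ = |steinSol z b - steinSol z a - steinDeriv z b * (b - a)| := by congr 1; ring
        _ ≤ _ := abs_steinSol_increment_le z b a
        _ = _ := by ring
  calc |√(pq p k) * (steinSol z a - steinSol z b) - steinDeriv z (f x) * (√(pq p k) * (a - b))|
      = √(pq p k) * |steinSol z a - steinSol z b - steinDeriv z (f x) * (a - b)| := by
        rw [← abs_of_pos h1, ← abs_mul, abs_of_pos h1]; congr 1; ring
    _ ≤ √(pq p k) * ((steinMono z a - steinMono z b) * (a - b)) := by gcongr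
    _ = _ := by field_simp

/-- The factor √(p_k q_k) inside the gradient cancels the denominator, leaving an increment of
`steinMono`, at most 2. -/
lemma abs_discreteGrad_steinMono_mul_le (h : IsRademacherLaw μ p) (f : (ℕ → ℝ) → ℝ) (z : ℝ)
    (k : ℕ) (x : ℕ → ℝ) :
    |discreteGrad p k (fun y => steinMono z (f y)) x * (discreteGrad p k f x / √(pq p k))| ≤
      2 * |discreteGrad p k f x| := by
  have h1 : 0 < √(pq p k) := Real.sqrt_pos.2 (h.pq_pos k)
  have e : discreteGrad p k (fun y => steinMono z (f y)) x * (discreteGrad p k f x / √(pq p k)) =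
      (steinMono z (f (Function.update x k 1)) - steinMono z (f (Function.update x k (-1)))) *
        discreteGrad p k f x := by
    conv_lhs => rw [discreteGrad]
    field_simp
  rw [e, abs_mul]
  gcongr
  exact abs_steinMono_sub_le _ _ _

lemma integrable_steinMono_term (h : IsRademacherLaw μ p) {f L : (ℕ → ℝ) → ℝ} (hm : Measurable f)
    (hf : MemLp f 2 μ) (hL : MemLp L 2 μ) (z : ℝ) (k : ℕ) :
    Integrable (fun x => discreteGrad p k (fun y => steinMono z (f y)) x *
      (discreteGrad p k f x / √(pq p k)) * |discreteGrad p k L x|) μ := by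
  have h1 : Integrable (fun x => 2 * (discreteGrad p k f x * discreteGrad p k L x)) μ :=
    ((h.memLp_discreteGrad k hf).integrable_mul (h.memLp_discreteGrad k hL)).const_mul 2
  refine h1.mono ?_ (Eventually.of_forall fun x => ?_)
  · refine AEStronglyMeasurable.mul (Measurable.aestronglyMeasurable ?_)
      (h.memLp_discreteGrad k hL).1.norm
    exact (measurable_discreteGrad p k ((measurable_steinMono z).comp hm)).mul
      ((measurable_discreteGrad p k hm).div_const _)
  · rw [Real.norm_eq_abs, Real.norm_eq_abs, abs_mul, abs_abs, ← mul_assoc,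
      abs_mul (2 * _), abs_mul (2 : ℝ), abs_two]
    exact mul_le_mul_of_nonneg_right (h.abs_discreteGrad_steinMono_mul_le f z k x) (abs_nonneg _)

variable [IsProbabilityMeasure μ]

lemma memLp_steinSol_comp {f : (ℕ → ℝ) → ℝ} (hm : Measurable f) (hf : MemLp f 2 μ) (z : ℝ) :
    MemLp (fun x => steinSol z (f x)) 2 μ := by
  have h0 : MemLp (fun x => |f x|) 2 μ := hf.norm
  have h1 : MemLp (fun x => |steinSol z 0| + |f x|) 2 μ := (memLp_const |steinSol z 0|).add h0
  refine h1.mono ((measurable_steinSol z).comp hm).aestronglyMeasurable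
    (Eventually.of_forall fun x => ?_)
  have h2 := abs_steinSol_sub_steinSol_le z (f x) 0
  rw [sub_zero] at h2
  have h3 := abs_sub_abs_le_abs_sub (steinSol z (f x)) (steinSol z 0)
  rw [Real.norm_eq_abs, Real.norm_eq_abs, abs_of_nonneg (a := |steinSol z 0| + |f x|)
    (by positivity)]
  linarith

lemma summable_integral_discreteGrad_steinSol_sq (h : IsRademacherLaw μ p)
    {f : (ℕ → ℝ) → ℝ} (hm : Measurable f) (hf : MemLp f 2 μ)
    (hfs : Summable fun k => ∫ x, discreteGrad p k f x ^ 2 ∂μ) (z : ℝ) :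
    Summable fun k => ∫ x, discreteGrad p k (fun y => steinSol z (f y)) x ^ 2 ∂μ := by
  refine Summable.of_nonneg_of_le (fun _ => integral_nonneg fun _ => sq_nonneg _)
    (fun k => ?_) hfs
  refine integral_mono (h.memLp_discreteGrad k (memLp_steinSol_comp hm hf z)).integrable_sq
    (h.memLp_discreteGrad k hf).integrable_sq fun x => ?_
  dsimp only
  rw [sq_le_sq, discreteGrad, discreteGrad, abs_mul, abs_mul]
  exact mul_le_mul_of_nonneg_left (abs_steinSol_sub_steinSol_le _ _ _) (abs_nonneg _)

section

variable {f L : (ℕ → ℝ) → ℝ}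

lemma integral_abs_steinMono_term_le (h : IsRademacherLaw μ p) (hm : Measurable f)
    (hf : MemLp f 2 μ) (hL : MemLp L 2 μ)
    (hfL : ∀ A : Finset ℕ, walshCoef μ p L A = -(walshCoef μ p f A / A.card)) (z : ℝ) (k : ℕ) :
    ∫ x, ‖discreteGrad p k (fun y => steinMono z (f y)) x *
      (discreteGrad p k f x / √(pq p k)) * |discreteGrad p k L x|‖ ∂μ ≤
      2 * ∫ x, discreteGrad p k f x ^ 2 ∂μ := by
  have mf := h.memLp_discreteGrad k hf
  have mL := h.memLp_discreteGrad k hL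
  calc _ ≤ ∫ x, 2 * |discreteGrad p k f x * discreteGrad p k L x| ∂μ := by
        refine integral_mono (h.integrable_steinMono_term hm hf hL z k).norm
          ((mf.integrable_mul mL).abs.const_mul 2) fun x => ?_
        dsimp only
        rw [Real.norm_eq_abs, abs_mul, abs_abs, abs_mul (discreteGrad p k f x), ← mul_assoc]
        exact mul_le_mul_of_nonneg_right (h.abs_discreteGrad_steinMono_mul_le f z k x)
          (abs_nonneg _)
    _ ≤ _ := by
        rw [integral_const_mul]
        have h1 := integral_abs_mul_le mf mL
        have h2 := h.integral_discreteGrad_sq_le hf hL hfL k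
        linarith

/-- The bound does not depend on z: it makes the supremum in part (1) finite and is the starting
point for part (3). -/
lemma steinMono_pairing (h : IsRademacherLaw μ p) (hm : Measurable f)
    (hf : MemLp f 2 μ) (hL : MemLp L 2 μ)
    (hfL : ∀ A : Finset ℕ, walshCoef μ p L A = -(walshCoef μ p f A / A.card))
    (hfs : Summable fun k => ∫ x, discreteGrad p k f x ^ 2 ∂μ) (z : ℝ) :
    (∀ᵐ x ∂μ, Summable fun k => discreteGrad p k (fun y => steinMono z (f y)) x *
      (discreteGrad p k f x / √(pq p k)) * |discreteGrad p k L x|) ∧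
    Integrable (fun x => ∑' k, discreteGrad p k (fun y => steinMono z (f y)) x *
      (discreteGrad p k f x / √(pq p k)) * |discreteGrad p k L x|) μ ∧
    ∫ x, ∑' k, discreteGrad p k (fun y => steinMono z (f y)) x *
      (discreteGrad p k f x / √(pq p k)) * |discreteGrad p k L x| ∂μ ≤
      2 * ∑' k, ∫ x, discreteGrad p k f x ^ 2 ∂μ := by
  have hi := h.integrable_steinMono_term hm hf hL z
  have hle := h.integral_abs_steinMono_term_le hm hf hL hfL z
  have hs := Summable.of_nonneg_of_le (fun _ => integral_nonneg fun _ => norm_nonneg _) hle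
    (hfs.mul_left 2)
  obtain ⟨h1, h2⟩ := ae_summable_and_integrable_tsum hi hs
  refine ⟨h1, h2, ?_⟩
  have h3 := hasSum_integral_of_summable_integral_norm hi hs
  rw [← h3.tsum_eq, ← tsum_mul_left]
  exact h3.summable.tsum_le_tsum (fun k => (le_abs_self _).trans
    ((norm_integral_le_integral_norm _).trans (hle k))) (hfs.mul_left 2)

lemma integrable_pairing_invOU (h : IsRademacherLaw μ p)
    {f L g : (ℕ → ℝ) → ℝ} (hf : MemLp f 2 μ) (hL : MemLp L 2 μ)
    (hfL : ∀ A : Finset ℕ, walshCoef μ p L A = -(walshCoef μ p f A / A.card))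
    (hfs : Summable fun k => ∫ x, discreteGrad p k f x ^ 2 ∂μ) (hg : MemLp g 2 μ)
    (hgs : Summable fun k => ∫ x, discreteGrad p k g x ^ 2 ∂μ) :
    (∀ᵐ x ∂μ, Summable fun k => discreteGrad p k g x * -discreteGrad p k L x) ∧
    Integrable (fun x => ∑' k, discreteGrad p k g x * -discreteGrad p k L x) μ := by
  have hLs := h.summable_integral_discreteGrad_sq hf hL hfL hfs
  have mg := fun k => h.memLp_discreteGrad k hg
  have mL := fun k => h.memLp_discreteGrad k hL
  refine ae_summable_and_integrable_tsum (fun k => (mg k).integrable_mul (mL k).neg) ?_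
  simpa using summable_integral_abs_mul mg mL hgs hLs

/-- The Malliavin-Stein bound for the distribution function at `z`. -/
lemma abs_measureReal_sub_le (h : IsRademacherLaw μ p) (hm : Measurable f)
    (hf : MemLp f 2 μ) (hL : MemLp L 2 μ)
    (hfL : ∀ A : Finset ℕ, walshCoef μ p L A = -(walshCoef μ p f A / A.card))
    (hfs : Summable fun k => ∫ x, discreteGrad p k f x ^ 2 ∂μ)
    (h0 : ∫ x, f x ∂μ = 0) (z : ℝ) :
    |μ.real {x | f x ≤ z} - stdNormalCDF z| ≤
      (∫ x, |1 - ∑' k, discreteGrad p k f x * -discreteGrad p k L x| ∂μ) +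
      ∫ x, ∑' k, discreteGrad p k (fun y => steinMono z (f y)) x *
        (discreteGrad p k f x / √(pq p k)) * |discreteGrad p k L x| ∂μ := by
  have hg := memLp_steinSol_comp hm hf z
  have hgs := h.summable_integral_discreteGrad_steinSol_sq hm hf hfs z
  obtain ⟨s0, i0⟩ := h.integrable_pairing_invOU hf hL hfL hfs hf hfs
  obtain ⟨s1, i1⟩ := h.integrable_pairing_invOU hf hL hfL hfs hg hgs
  obtain ⟨s2, i2, -⟩ := h.steinMono_pairing hm hf hL hfL hfs z
  have hibp := h.integral_mul_eq_integral_tsum hf hg hL hfL hfs hgs h0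
  set S0 := fun x => ∑' k, discreteGrad p k f x * -discreteGrad p k L x
  set S1 := fun x => ∑' k, discreteGrad p k (fun y => steinSol z (f y)) x * -discreteGrad p k L x
  set S2 := fun x => ∑' k, discreteGrad p k (fun y => steinMono z (f y)) x *
        (discreteGrad p k f x / √(pq p k)) * |discreteGrad p k L x|
  set D := fun x => steinDeriv z (f x)
  have mD : Measurable D := (measurable_steinDeriv z).comp hm
  have hD : ∀ x, |D x| ≤ 1 := fun x => abs_steinDeriv_le_one z (f x)
  have iD : Integrable D μ := Integrable.of_bound mD.aestronglyMeasurable 1 (.of_forall hD)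
  have iD1 : Integrable (fun x => D x * (1 - S0 x)) μ :=
    ((integrable_const 1).sub i0).bdd_mul mD.aestronglyMeasurable (.of_forall hD)
  have iD0 : Integrable (fun x => D x * S0 x) μ :=
    i0.bdd_mul mD.aestronglyMeasurable (.of_forall hD)
  have iDS : Integrable (fun x => D x * S0 x - S1 x) μ := iD0.sub i1
  have iA : Integrable (fun x => |1 - S0 x|) μ := ((integrable_const 1).sub i0).abs
  have ms : MeasurableSet {x | f x ≤ z} := hm measurableSet_Iic
  -- Stein's equation and integration by parts give E[D] - E[S1]; adding and subtracting E[D S0]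
  -- isolates the chain rule remainder D S0 - S1.
  have e : μ.real {x | f x ≤ z} - stdNormalCDF z = ∫ x, (D x * (1 - S0 x) + (D x * S0 x - S1 x)) ∂μ := by
    have e1 : ∀ x, D x = f x * steinSol z (f x) +
        (Set.indicator {x | f x ≤ z} 1 x - stdNormalCDF z) := fun x => by
      simp only [D, steinDeriv, Set.indicator_apply, Set.mem_Iic, Set.mem_ofPred_eq,
        Pi.one_apply]
      ring
    have iI : Integrable (fun x => Set.indicator {x | f x ≤ z} (1 : (ℕ → ℝ) → ℝ) x) μ :=
      (integrable_const 1).indicator ms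
    have iJ : Integrable (fun x => Set.indicator {x | f x ≤ z} (1 : (ℕ → ℝ) → ℝ) x -
      stdNormalCDF z) μ := iI.sub (integrable_const _)
    have iK : Integrable (fun x => f x * steinSol z (f x)) μ := hf.integrable_mul hg
    have e2 : ∫ x, D x ∂μ = ∫ x, f x * steinSol z (f x) ∂μ +
        (μ.real {x | f x ≤ z} - stdNormalCDF z) := by
      simp only [e1]
      rw [integral_add iK iJ,
        integral_sub iI (integrable_const _), integral_indicator_one ms]
      simp
    rw [integral_add iD1 iDS, integral_sub iD0 i1, ← hibp]
    have e3 : ∫ x, D x * (1 - S0 x) ∂μ = ∫ x, D x ∂μ - ∫ x, D x * S0 x ∂μ := by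
      rw [← integral_sub iD iD0]; congr 1; ext x; ring
    rw [e3, e2]; ring
  rw [e, ← integral_add iA i2]
  refine abs_integral_le_integral_abs.trans ?_
  refine integral_mono_ae (iD1.add iDS).abs (iA.add i2) ?_
  filter_upwards [s0, s1, s2, h.ae_abs_discreteGrad_steinSol_sub_le f z] with x x0 x1 x2 hx
  refine (abs_add_le _ _).trans (add_le_add ?_ ?_)
  · rw [abs_mul]
    exact mul_le_of_le_one_left (abs_nonneg _) (hD x)
  · have e4 : D x * S0 x - S1 x = ∑' k, (discreteGrad p k (fun y => steinSol z (f y)) x -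
        D x * discreteGrad p k f x) * discreteGrad p k L x := by
      simp only [S0, S1]
      rw [← tsum_mul_left, ← (x0.mul_left (D x)).tsum_sub x1]
      refine tsum_congr fun k => ?_
      ring
    rw [e4]
    have hb : ∀ k, ‖(discreteGrad p k (fun y => steinSol z (f y)) x -
        D x * discreteGrad p k f x) * discreteGrad p k L x‖ ≤
        discreteGrad p k (fun y => steinMono z (f y)) x *
        (discreteGrad p k f x / √(pq p k)) * |discreteGrad p k L x| := fun k => by
      rw [Real.norm_eq_abs, abs_mul]
      exact mul_le_mul_of_nonneg_right (hx k) (abs_nonneg _)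
    exact tsum_of_norm_bounded x2.hasSum hb

end

end IsRademacherLaw

/-- The energy is controlled by the fourth moments of the gradient. -/
lemma tsum_lintegral_sq_le {α : Type*} [MeasurableSpace α] {ν : Measure α}
    [IsProbabilityMeasure ν] {u : ℕ → α → ℝ} (hu : ∀ k, AEMeasurable (u k) ν) {c : ℕ → ℝ}
    (hc : ∀ k, 0 < c k) (s : Set ℕ) (hs : ∀ k ∉ s, ∫⁻ x, ENNReal.ofReal (u k x ^ 2) ∂ν = 0) :
    ∑' k, ∫⁻ x, ENNReal.ofReal (u k x ^ 2) ∂ν ≤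
      (∑' k, s.indicator (fun k => ENNReal.ofReal (c k)) k) ^ (1 / 2 : ℝ) *
      (∑' k, ENNReal.ofReal (c k)⁻¹ * ∫⁻ x, ENNReal.ofReal (u k x ^ 4) ∂ν) ^ (1 / 2 : ℝ) := by
  have h22 : (2 : ℝ).HolderConjugate 2 := Real.HolderConjugate.two_two
  -- Cauchy-Schwarz against the constant 1 on a probability space.
  have jensen : ∀ k, ∫⁻ x, ENNReal.ofReal (u k x ^ 2) ∂ν ≤
      (∫⁻ x, ENNReal.ofReal (u k x ^ 4) ∂ν) ^ (1 / 2 : ℝ) := fun k => by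
    have h1 := ENNReal.lintegral_mul_le_Lp_mul_Lq ν h22
      (f := fun x => ENNReal.ofReal (u k x ^ 2)) (g := fun _ => 1)
      ((hu k).pow_const 2).ennreal_ofReal aemeasurable_const
    simp only [Pi.mul_apply, mul_one, ENNReal.one_rpow, lintegral_one, measure_univ] at h1
    refine h1.trans_eq ?_
    congr 1
    refine lintegral_congr fun x => ?_
    rw [ENNReal.ofReal_rpow_of_nonneg (sq_nonneg _) (by norm_num)]
    congr 1
    norm_cast
    ring
  have key : ∀ k, ∫⁻ x, ENNReal.ofReal (u k x ^ 2) ∂ν ≤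
      (s.indicator (fun k => ENNReal.ofReal (c k)) k) ^ (1 / 2 : ℝ) *
      (ENNReal.ofReal (c k)⁻¹ * ∫⁻ x, ENNReal.ofReal (u k x ^ 4) ∂ν) ^ (1 / 2 : ℝ) := fun k => by
    by_cases hk : k ∈ s
    · rw [Set.indicator_of_mem hk, ← ENNReal.mul_rpow_of_nonneg _ _ (by norm_num), ← mul_assoc,
        ← ENNReal.ofReal_mul (hc k).le, mul_inv_cancel₀ (hc k).ne', ENNReal.ofReal_one, one_mul]
      exact jensen k
    · rw [hs k hk]; exact zero_le
  refine (ENNReal.tsum_le_tsum key).trans ?_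
  -- Second Cauchy-Schwarz, now over k, after inserting √(c k) · √(c k)⁻¹ on s.
  have h2 := ENNReal.lintegral_mul_le_Lp_mul_Lq (Measure.count : Measure ℕ) h22
    (f := fun k => (s.indicator (fun k => ENNReal.ofReal (c k)) k) ^ (1 / 2 : ℝ))
    (g := fun k => (ENNReal.ofReal (c k)⁻¹ *
      ∫⁻ x, ENNReal.ofReal (u k x ^ 4) ∂ν) ^ (1 / 2 : ℝ))
    (measurable_of_countable _).aemeasurable (measurable_of_countable _).aemeasurable
  simp only [lintegral_count, Pi.mul_apply, ← ENNReal.rpow_mul] at h2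
  norm_num at h2 ⊢
  exact h2

end Rademacher
end

noncomputable section

namespace Rademacher

/-! ## Chaos expansions in a Hilbert space with a basis indexed by finite sets -/

section Chaos

/-- The set of entries of a tuple. -/
def tupleSet {n : ℕ} (i : Fin n → ℕ) : Finset ℕ := Finset.univ.image i

lemma coe_tupleSet {n : ℕ} (i : Fin n → ℕ) : (tupleSet i : Set ℕ) = Set.range i := by
  simp [tupleSet]

lemma card_tupleSet {n : ℕ} {i : Fin n → ℕ} (hi : Function.Injective i) :
    (tupleSet i).card = n := by
  simp [tupleSet, Finset.card_image_of_injective _ hi]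

lemma tupleSet_comp_perm {n : ℕ} (i : Fin n → ℕ) (σ : Equiv.Perm (Fin n)) :
    tupleSet (i ∘ σ) = tupleSet i := by
  rw [← Finset.coe_inj, coe_tupleSet, coe_tupleSet, σ.surjective.range_comp]

/-- A tuple with distinct entries is recovered from its increasing rearrangement, fixed by the set
of entries, and the sorting permutation. -/
lemma eq_of_sort_eq {n : ℕ} {i j : Fin n → ℕ} (hi : Function.Injective i)
    (hj : Function.Injective j) (hs : Tuple.sort i = Tuple.sort j)
    (h : tupleSet i = tupleSet j) : i = j := by
  have h1 : i ∘ Tuple.sort i = j ∘ Tuple.sort j := by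
    refine (StrictMono.range_inj
      ((Tuple.monotone_sort i).strictMono_of_injective (hi.comp (Equiv.injective _)))
      ((Tuple.monotone_sort j).strictMono_of_injective (hj.comp (Equiv.injective _)))).1 ?_
    rw [(Tuple.sort i).surjective.range_comp, (Tuple.sort j).surjective.range_comp,
      ← coe_tupleSet, ← coe_tupleSet, h]
  funext k
  have h2 := congrFun h1 ((Tuple.sort i).symm k)
  rw [Function.comp_apply, Function.comp_apply, ← hs, Equiv.apply_symm_apply] at h2
  exact h2

/-- A family indexed by tuples with distinct entries is summable as soon as it is summable along
all families of tuples that are determined by their set of entries. -/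
lemma summable_of_injOn_tupleSet {E : Type*} [NormedAddCommGroup E] {n : ℕ}
    {g : (Fin n → ℕ) → E} (h0 : ∀ i, ¬ Function.Injective i → g i = 0)
    (h : ∀ S : Set (Fin n → ℕ), (∀ i ∈ S, Function.Injective i) → S.InjOn tupleSet →
      Summable fun i : S => g i) : Summable g := by
  classical
  -- Splitting by sorting permutation gives n! families, each determined by the set of entries.
  have e : g = fun i => ∑ σ : Equiv.Perm (Fin n),
      Set.indicator {i | Function.Injective i ∧ Tuple.sort i = σ} g i := by
    funext i
    by_cases hi : Function.Injective i
    · rw [Finset.sum_eq_single (Tuple.sort i), Set.indicator_of_mem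
        (show i ∈ {j | Function.Injective j ∧ Tuple.sort j = Tuple.sort i} from ⟨hi, rfl⟩)]
      · intro σ _ hσ
        exact Set.indicator_of_notMem (fun hm => hσ hm.2.symm) _
      · simp
    · rw [h0 i hi, Finset.sum_eq_zero]
      intro σ _
      exact Set.indicator_of_notMem (fun hm => hi hm.1) _
  rw [e]
  refine summable_sum fun σ _ => summable_subtype_iff_indicator.1 (h _ (fun i hi => hi.1) ?_)
  intro i hi j hj hij
  exact eq_of_sort_eq hi.1 hj.1 (hi.2.trans hj.2.symm) hij

variable {H : Type*} [NormedAddCommGroup H] [InnerProductSpace ℝ H]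

open Classical in
/-- The summands of a multiple integral with respect to a family indexed by finite sets. -/
def chaosTerm (e : Finset ℕ → H) {n : ℕ} (f : (Fin n → ℕ) → ℝ) (i : Fin n → ℕ) : H :=
  if Function.Injective i then f i • e (tupleSet i) else 0

/-- The multiple integral with respect to a family indexed by finite sets. -/
def chaosSum (e : Finset ℕ → H) {n : ℕ} (f : (Fin n → ℕ) → ℝ) : H := ∑' i, chaosTerm e f i

open Classical in
/-- The tuples with distinct entries enumerating a given finite set. -/
def tupleFiber (n : ℕ) (A : Finset ℕ) : Finset (Fin n → ℕ) :=
  {i ∈ Fintype.piFinset fun _ => A | Function.Injective i ∧ tupleSet i = A}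

lemma mem_tupleFiber {n : ℕ} {A : Finset ℕ} {i : Fin n → ℕ} :
    i ∈ tupleFiber n A ↔ Function.Injective i ∧ tupleSet i = A := by
  simp only [tupleFiber, Finset.mem_filter, Fintype.mem_piFinset, and_iff_right_iff_imp]
  rintro ⟨_, rfl⟩ k
  exact Finset.mem_image_of_mem _ (Finset.mem_univ k)

lemma tupleFiber_eq_empty {n : ℕ} {A : Finset ℕ} (h : A.card ≠ n) : tupleFiber n A = ∅ := by
  refine Finset.eq_empty_of_forall_notMem fun i hi => h ?_
  obtain ⟨hinj, rfl⟩ := mem_tupleFiber.1 hi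
  exact card_tupleSet hinj

lemma tupleFiber_nonempty {n : ℕ} {A : Finset ℕ} (h : A.card = n) : (tupleFiber n A).Nonempty := by
  refine ⟨A.orderEmbOfFin h, mem_tupleFiber.2 ⟨(A.orderEmbOfFin h).injective, ?_⟩⟩
  rw [← Finset.coe_inj, coe_tupleSet, Finset.range_orderEmbOfFin]

/-- Permuted tuples carry the same basis vector, so the terms are not orthogonal as a whole; they
are along every family on which `tupleSet` is injective. -/
lemma summable_chaosTerm [CompleteSpace H] {e : Finset ℕ → H} (he : Orthonormal ℝ e) {n : ℕ}
    {f : (Fin n → ℕ) → ℝ} (hf : Summable fun i => f i ^ 2) : Summable (chaosTerm e f) := by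
  refine summable_of_injOn_tupleSet (fun i hi => if_neg hi) fun S hS hinj => ?_
  have h1 := (he.comp (fun i : S => tupleSet i.1) fun i j hij =>
    Subtype.ext (hinj i.2 j.2 hij)).orthogonalFamily.summable_iff_norm_sq_summable
      (fun i : S => f i)
  simp only [LinearIsometry.toSpanSingleton_apply, Function.comp_apply, Real.norm_eq_abs,
    sq_abs] at h1
  refine (h1.2 (hf.subtype S)).congr fun i => ?_
  rw [chaosTerm, if_pos (hS i i.2)]

lemma inner_chaosSum [CompleteSpace H] {e : Finset ℕ → H} (he : Orthonormal ℝ e) {n : ℕ}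
    {f : (Fin n → ℕ) → ℝ} (hf : Summable fun i => f i ^ 2) (A : Finset ℕ) :
    inner ℝ (e A) (chaosSum e f) = ∑ i ∈ tupleFiber n A, f i := by
  classical
  have h1 := (summable_chaosTerm he hf).hasSum.mapL (innerSL ℝ (e A))
  have h2 : HasSum (fun i => (innerSL ℝ (e A)) (chaosTerm e f i))
      (∑ i ∈ tupleFiber n A, (innerSL ℝ (e A)) (chaosTerm e f i)) := by
    refine hasSum_sum_of_ne_finset_zero fun i hi => ?_
    rw [chaosTerm]
    split_ifs with hinj
    · have hne : A ≠ tupleSet i := fun hA => hi (mem_tupleFiber.2 ⟨hinj, hA.symm⟩)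
      rw [innerSL_apply_apply, inner_smul_right, he.2 hne, mul_zero]
    · simp
  refine (h1.unique h2).trans ?_
  refine Finset.sum_congr rfl fun i hi => ?_
  obtain ⟨hinj, hA⟩ := mem_tupleFiber.1 hi
  rw [chaosTerm, if_pos hinj, innerSL_apply_apply, inner_smul_right, hA,
    real_inner_self_eq_norm_sq, he.1]
  simp

lemma inner_chaosSum_of_card_ne [CompleteSpace H] {e : Finset ℕ → H} (he : Orthonormal ℝ e)
    {n : ℕ} {f : (Fin n → ℕ) → ℝ} (hf : Summable fun i => f i ^ 2) {A : Finset ℕ}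
    (hA : A.card ≠ n) : inner ℝ (e A) (chaosSum e f) = 0 := by
  rw [inner_chaosSum he hf, tupleFiber_eq_empty hA, Finset.sum_empty]

lemma eq_of_forall_inner_eq (b : HilbertBasis (Finset ℕ) ℝ H) {v w : H}
    (h : ∀ A, inner ℝ (b A) v = inner ℝ (b A) w) : v = w := by
  refine b.repr.injective (lp.ext (funext fun A => ?_))
  rw [b.repr_apply_apply, b.repr_apply_apply, h A]

lemma summable_inner_sq (b : HilbertBasis (Finset ℕ) ℝ H) (F : H) :
    Summable fun A => inner ℝ (b A) F ^ 2 := by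
  refine (b.summable_inner_mul_inner F F).congr fun A => ?_
  rw [real_inner_comm, sq]

variable [CompleteSpace H]

/-- Existence of the chaos expansion. -/
lemma exists_hasSum_chaosSum (b : HilbertBasis (Finset ℕ) ℝ H) (F : H) :
    ∃ f : (n : ℕ) → (Fin n → ℕ) → ℝ, (∀ n, IsKernel n (f n)) ∧
      HasSum (fun n => chaosSum b (f n)) F := by
  classical
  set c : Finset ℕ → ℝ := fun A => inner ℝ (b A) F
  -- Each coefficient is divided equally among all enumerations of its set, which makes the kernel
  -- symmetric and restores the coefficient on summation.
  set f : (n : ℕ) → (Fin n → ℕ) → ℝ := fun n i =>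
    if Function.Injective i then c (tupleSet i) / (tupleFiber n (tupleSet i)).card else 0
  have hk : ∀ n, IsKernel n (f n) := fun n => by
    refine ⟨?_, fun σ i => ?_, fun i hi => if_neg hi⟩
    · refine summable_of_injOn_tupleSet (fun i hi => by simp [f, hi]) fun S hS hinj => ?_
      have h1 : Summable fun i : S => c (tupleSet i.1) ^ 2 :=
        (summable_inner_sq b F).comp_injective (i := fun i : S => tupleSet i.1)
          fun i j hij => Subtype.ext (hinj i.2 j.2 hij)
      refine Summable.of_nonneg_of_le (fun _ => sq_nonneg _) (fun i => ?_) h1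
      simp only [f, if_pos (hS i i.2)]
      have h2 : (1 : ℝ) ≤ (tupleFiber n (tupleSet i.1)).card := by
        exact_mod_cast Finset.card_pos.2 ⟨i.1, mem_tupleFiber.2 ⟨hS i i.2, rfl⟩⟩
      rw [div_pow]
      exact div_le_self (sq_nonneg _) (one_le_pow₀ h2)
    · simp only [f, tupleSet_comp_perm, Function.Injective.of_comp_iff' _ σ.bijective]
  refine ⟨f, hk, ?_⟩
  have h1 : HasSum (fun A => c A • b A) F := by
    refine (b.hasSum_repr F).congr_fun fun A => ?_
    rw [b.repr_apply_apply]
  have h2 := (Equiv.sigmaFiberEquiv (Finset.card : Finset ℕ → ℕ)).hasSum_iff.2 h1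
  -- The basis expansion is grouped by the cardinality of A.
  refine h2.sigma fun n => ?_
  have h3 : Summable fun A : {A : Finset ℕ // A.card = n} => c A • b A :=
    h1.summable.subtype {A : Finset ℕ | A.card = n}
  suffices hs : chaosSum b (f n) = ∑' A : {A : Finset ℕ // A.card = n}, c A • b A by
    rw [hs]; exact h3.hasSum
  refine eq_of_forall_inner_eq b fun A => ?_
  rw [inner_chaosSum b.orthonormal (hk n).1]
  have h4 := h3.hasSum.mapL (innerSL ℝ (b A))
  have h5 : ∀ B, (innerSL ℝ (b A)) (c B • b B) = if A = B then c A else 0 := fun B => by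
    rw [innerSL_apply_apply, inner_smul_right, orthonormal_iff_ite.1 b.orthonormal]
    split_ifs with h
    · rw [h, mul_one]
    · rw [mul_zero]
  simp only [h5] at h4
  change _ = (innerSL ℝ (b A)) _
  by_cases hA : A.card = n
  · have h6 := hasSum_ite_eq (⟨A, hA⟩ : {A : Finset ℕ // A.card = n}) (c A)
    rw [h4.unique (h6.congr_fun fun B => by simp [Subtype.ext_iff, eq_comm])]
    have h7 : ∀ i ∈ tupleFiber n A, f n i = c A / (tupleFiber n A).card := fun i hi => by
      obtain ⟨hinj, rfl⟩ := mem_tupleFiber.1 hi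
      exact if_pos hinj
    rw [Finset.sum_congr rfl h7, Finset.sum_const, nsmul_eq_mul]
    have : ((tupleFiber n A).card : ℝ) ≠ 0 := by
      exact_mod_cast (tupleFiber_nonempty hA).card_pos.ne'
    field_simp
  · rw [tupleFiber_eq_empty hA, Finset.sum_empty]
    refine h4.unique ?_ |>.symm
    refine hasSum_zero.congr_fun fun B => if_neg fun h => hA ?_
    rw [h]; exact B.2

/-- Dividing the terms of a chaos expansion by their order. -/
lemma summable_and_inner_tsum_chaosSum (b : HilbertBasis (Finset ℕ) ℝ H)
    {f : (n : ℕ) → (Fin n → ℕ) → ℝ} (hf : ∀ n, 1 ≤ n → IsKernel n (f n)) {G : H}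
    (hG : HasSum (fun n => chaosSum b (f (n + 1))) G) :
    (Summable fun n : ℕ => (-(1 / ((n : ℝ) + 1))) • chaosSum b (f (n + 1))) ∧
    ∀ A, inner ℝ (b A) (∑' n : ℕ, (-(1 / ((n : ℝ) + 1))) • chaosSum b (f (n + 1))) =
      -(inner ℝ (b A) G / A.card) := by
  set v : ℕ → H := fun n => chaosSum b (f (n + 1))
  have hsq : ∀ n : ℕ, Summable fun i => f (n + 1) i ^ 2 := fun n => (hf _ n.succ_pos).1
  have hv : ∀ n A, A.card ≠ n + 1 → inner ℝ (b A) (v n) = 0 := fun n A hA =>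
    inner_chaosSum_of_card_ne b.orthonormal (hsq n) hA
  have horth : ∀ m n, m ≠ n → inner ℝ (v m) (v n) = 0 := fun m n hmn => by
    rw [← b.tsum_inner_mul_inner]
    refine (tsum_congr fun A => ?_).trans tsum_zero
    by_cases hA : A.card = m + 1
    · rw [hv n A (by omega), mul_zero]
    · rw [real_inner_comm, hv m A hA, zero_mul]
  -- Chaoses of different orders are orthogonal, so convergence is square-summability of norms, and
  -- the factors 1/(n + 1) ≤ 1 preserve it.
  have hfam : OrthogonalFamily ℝ (fun n => Submodule.span ℝ {v n})
      fun n => (Submodule.span ℝ {v n}).subtypeₗᵢ := by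
    refine OrthogonalFamily.of_pairwise fun m n hmn => ?_
    refine Submodule.isOrtho_span.2 ?_
    rintro x rfl y rfl
    exact horth m n hmn
  have hmem : ∀ n, v n ∈ Submodule.span ℝ {v n} := fun n => Submodule.mem_span_singleton_self _
  have hs : Summable fun n : ℕ => (-(1 / ((n : ℝ) + 1))) • v n := by
    have h1 := (hfam.summable_iff_norm_sq_summable fun n => ⟨v n, hmem n⟩).1 hG.summable
    refine (hfam.summable_iff_norm_sq_summable fun n : ℕ =>
      ⟨(-(1 / ((n : ℝ) + 1))) • v n, Submodule.smul_mem _ _ (hmem n)⟩).2 ?_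
    refine Summable.of_nonneg_of_le (fun _ => sq_nonneg _) (fun n => ?_) h1
    simp only [Submodule.coe_norm]
    rw [norm_smul, mul_pow]
    refine mul_le_of_le_one_left (sq_nonneg _) (pow_le_one₀ (norm_nonneg _) ?_)
    rw [norm_neg, Real.norm_of_nonneg (by positivity)]
    exact (div_le_one (by positivity)).2 (by linarith [n.cast_nonneg (α := ℝ)])
  refine ⟨hs, fun A => ?_⟩
  have h1 := hG.mapL (innerSL ℝ (b A))
  have h2 := hs.hasSum.mapL (innerSL ℝ (b A))
  simp only [innerSL_apply_apply, inner_smul_right] at h1 h2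
  -- At A = ∅ the right side is a division by zero, equal to 0 by convention, in agreement with the
  -- absence of an order-zero term.
  rcases Nat.eq_zero_or_pos A.card with h0 | hpos
  · rw [h0, Nat.cast_zero, div_zero, neg_zero]
    refine h2.unique (hasSum_zero.congr_fun fun n => ?_)
    change _ * inner ℝ (b A) (v n) = _
    rw [hv n A (by omega), mul_zero]
  · obtain ⟨m, hm⟩ := Nat.exists_eq_add_of_lt hpos
    rw [zero_add] at hm
    have e1 := h1.unique (hasSum_single m fun n hn => hv n A (by omega))
    have e2 := h2.unique (hasSum_single m fun n hn => by
      change _ * inner ℝ (b A) (v n) = _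
      rw [hv n A (by omega), mul_zero])
    rw [e2, e1, hm]
    push_cast
    ring

end Chaos

end Rademacher
end

noncomputable section

namespace Rademacher

/-! ## Transfer to the sequence space -/

section Transfer

variable {Ω : Type*} [MeasurableSpace Ω] {P : Measure Ω} {p : ℕ → ℝ} {X : ℕ → Ω → ℝ}

/-- The law of the sequence `X`. -/
def seqLaw (P : Measure Ω) (X : ℕ → Ω → ℝ) : Measure (ℕ → ℝ) := P.map fun ω k => X k ω

namespace IsRademacherSeq

lemma measurable_seq (hX : IsRademacherSeq P p X) : Measurable fun ω k => X k ω :=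
  measurable_pi_iff.2 hX.measurable

lemma measurePreserving (hX : IsRademacherSeq P p X) :
    MeasurePreserving (fun ω k => X k ω) P (seqLaw P X) :=
  ⟨hX.measurable_seq, rfl⟩

variable [IsProbabilityMeasure P]

lemma isProbabilityMeasure_seqLaw (hX : IsRademacherSeq P p X) :
    IsProbabilityMeasure (seqLaw P X) :=
  Measure.isProbabilityMeasure_map hX.measurable_seq.aemeasurable

lemma map_apply (hX : IsRademacherSeq P p X) (k : ℕ) {t : Set ℝ} (ht : MeasurableSet t) :
    P.map (X k) t = ENNReal.ofReal (p k) * t.indicator 1 1 +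
      ENNReal.ofReal (1 - p k) * t.indicator 1 (-1) := by
  classical
  have hp := hX.mem_Ioo k
  have m1 : MeasurableSet {ω | X k ω = 1} := hX.measurable k (measurableSet_singleton 1)
  have m2 : MeasurableSet {ω | X k ω = -1} := hX.measurable k (measurableSet_singleton (-1))
  have hd : Disjoint {ω | X k ω = 1} {ω | X k ω = -1} := by
    rw [Set.disjoint_left]
    intro ω h1 h2
    simp only [Set.mem_ofPred_eq] at h1 h2
    linarith
  have hU : P ({ω | X k ω = 1} ∪ {ω | X k ω = -1})ᶜ = 0 := by
    rw [prob_compl_eq_zero_iff (m1.union m2), measure_union hd m2, hX.prob_one, hX.prob_neg_one,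
      ← ENNReal.ofReal_add hp.1.le (sub_pos.2 hp.2).le]
    simp
  have aux : ∀ s : ℝ, P (X k ⁻¹' t ∩ {ω | X k ω = s}) = P {ω | X k ω = s} * t.indicator 1 s := by
    intro s
    by_cases hs : s ∈ t
    · rw [Set.indicator_of_mem hs, Pi.one_apply, mul_one, Set.inter_eq_right.2]
      intro ω hω
      have : X k ω = s := hω
      simpa [this] using hs
    · rw [Set.indicator_of_notMem hs, mul_zero]
      convert measure_empty (μ := P)
      ext ω
      simp only [Set.mem_inter_iff, Set.mem_preimage, Set.mem_ofPred_eq, Set.mem_empty_iff_false,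
        iff_false, not_and]
      rintro h1 rfl
      exact hs h1
  rw [Measure.map_apply (hX.measurable k) ht,
    ← measure_inter_add_sdiff _ (m1.union m2), measure_mono_null (Set.sdiff_subset_compl _ _) hU, add_zero,
    Set.inter_union_distrib_left, measure_union (hd.mono Set.inter_subset_right
      Set.inter_subset_right) ((hX.measurable k ht).inter m2), aux, aux, hX.prob_one,
    hX.prob_neg_one]

/-- By independence the law is an infinite product, so comparison on finite boxes suffices. An
update at k replaces the k-th factor by an indicator, and the p_k, q_k mixture restores it. -/
lemma isRademacherLaw (hX : IsRademacherSeq P p X) : IsRademacherLaw (seqLaw P X) p := by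
  classical
  refine ⟨hX.mem_Ioo, fun k => ?_⟩
  have hprob : ∀ i, IsProbabilityMeasure (P.map (X i)) := fun i =>
    Measure.isProbabilityMeasure_map (hX.measurable i).aemeasurable
  have hlaw : seqLaw P X = Measure.infinitePi fun i => P.map (X i) :=
    hX.indep.map_fun_eq_infinitePi_map hX.measurable
  rw [hlaw]
  symm
  refine Measure.eq_infinitePi _ fun s t ht => ?_
  have hm : ∀ s' : Finset ℕ, MeasurableSet ((s' : Set ℕ).pi t) := fun s' =>
    MeasurableSet.pi s'.countable_toSet fun i _ => ht i
  have key : ∀ r : ℝ, (Measure.infinitePi fun i => P.map (X i)).map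
      (fun x => Function.update x k r) ((s : Set ℕ).pi t) =
      if k ∈ s then (t k).indicator 1 r * ∏ i ∈ s.erase k, P.map (X i) (t i)
      else ∏ i ∈ s, P.map (X i) (t i) := fun r => by
    rw [Measure.map_apply (measurable_update_const k r) (hm s)]
    split_ifs with hk
    · by_cases hr : r ∈ t k
      · rw [Set.indicator_of_mem hr, Pi.one_apply, one_mul,
          ← Measure.infinitePi_pi (fun i => P.map (X i)) fun i _ => ht i]
        congr 1
        ext x
        simp only [Set.mem_preimage, Set.mem_pi, Finset.mem_coe, Finset.mem_erase]
        refine ⟨fun h i hi => ?_, fun h i hi => ?_⟩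
        · have := h i hi.2
          rwa [Function.update_of_ne hi.1] at this
        · by_cases hik : i = k
          · subst hik; simpa using hr
          · rw [Function.update_of_ne hik]; exact h i ⟨hik, hi⟩
      · rw [Set.indicator_of_notMem hr, zero_mul]
        convert measure_empty (μ := Measure.infinitePi fun i => P.map (X i))
        ext x
        simp only [Set.mem_preimage, Set.mem_pi, Finset.mem_coe, Set.mem_empty_iff_false,
          iff_false]
        intro h
        have := h k hk
        rw [Function.update_self] at this
        exact hr this
    · rw [← Measure.infinitePi_pi (fun i => P.map (X i)) fun i _ => ht i]
      congr 1
      ext x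
      simp only [Set.mem_preimage, Set.mem_pi, Finset.mem_coe]
      refine forall₂_congr fun i hi => ?_
      rw [Function.update_of_ne (ne_of_mem_of_not_mem hi hk)]
  have hp := hX.mem_Ioo k
  rw [Measure.add_apply, Measure.smul_apply, Measure.smul_apply, key, key, smul_eq_mul,
    smul_eq_mul]
  split_ifs with hk
  · rw [← Finset.mul_prod_erase s _ hk, hX.map_apply k (ht k)]
    ring
  · rw [← add_mul, ← ENNReal.ofReal_add hp.1.le (sub_pos.2 hp.2).le]
    simp

end IsRademacherSeq

/-! ### Representatives -/

lemma exists_representative {F : Ω → ℝ} (hF : AEStronglyMeasurable[sigmaX X] F P) :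
    ∃ f : (ℕ → ℝ) → ℝ, Measurable f ∧ F =ᵐ[P] fun ω => f (fun k => X k ω) := by
  obtain ⟨g, hg, hFg⟩ := hF
  obtain ⟨f, hf, rfl⟩ := hg.measurable.exists_eq_measurable_comp
  exact ⟨f, hf, hFg⟩

lemma representative_spec {F : Ω → ℝ} (hF : AEStronglyMeasurable[sigmaX X] F P) :
    Measurable (representative P X F) ∧
      F =ᵐ[P] fun ω => representative P X F (fun k => X k ω) := by
  have h := exists_representative hF
  rw [representative, dif_pos h]
  exact h.choose_spec

lemma aestronglyMeasurable_comp_seq {f : (ℕ → ℝ) → ℝ} (hf : Measurable f) :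
    AEStronglyMeasurable[sigmaX X] (fun ω => f (fun k => X k ω)) P :=
  (hf.comp (comap_measurable _)).stronglyMeasurable.aestronglyMeasurable

lemma IsRademacherSeq.ae_comp_iff (hX : IsRademacherSeq P p X) {f g : (ℕ → ℝ) → ℝ}
    (hf : Measurable f) (hg : Measurable g) :
    (∀ᵐ ω ∂P, f (fun k => X k ω) = g (fun k => X k ω)) ↔ f =ᵐ[seqLaw P X] g :=
  (ae_map_iff hX.measurable_seq.aemeasurable (measurableSet_eq_fun hf hg)).symm

lemma IsRademacherSeq.ae_of_ae_seqLaw (hX : IsRademacherSeq P p X) {Q : (ℕ → ℝ) → Prop}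
    (h : ∀ᵐ x ∂(seqLaw P X), Q x) : ∀ᵐ ω ∂P, Q (fun k => X k ω) :=
  ae_of_ae_map hX.measurable_seq.aemeasurable h

lemma IsRademacherLaw.discreteGrad_congr {μ : Measure (ℕ → ℝ)} (h : IsRademacherLaw μ p)
    {f g : (ℕ → ℝ) → ℝ} (hfg : f =ᵐ[μ] g) :
    ∀ᵐ x ∂μ, ∀ k, discreteGrad p k f x = discreteGrad p k g x := by
  rw [ae_all_iff]
  intro k
  filter_upwards [h.ae_update k (Or.inl rfl) hfg, h.ae_update k (Or.inr rfl) hfg] with x h1 h2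
  rw [discreteGrad, discreteGrad, h1, h2]

lemma representative_ae_eq (hX : IsRademacherSeq P p X) {F : Ω → ℝ} {g : (ℕ → ℝ) → ℝ}
    (hg : Measurable g) (hFg : F =ᵐ[P] fun ω => g (fun k => X k ω)) :
    representative P X F =ᵐ[seqLaw P X] g := by
  obtain ⟨h1, h2⟩ := representative_spec
    ((aestronglyMeasurable_comp_seq (X := X) (P := P) hg).congr hFg.symm)
  exact (hX.ae_comp_iff h1 hg).1 (h2.symm.trans hFg)

lemma grad_eq (F : Ω → ℝ) (k : ℕ) (ω : Ω) :
    grad P p X F k ω = discreteGrad p k (representative P X F) (fun j => X j ω) := rfl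

/-- Representatives agree almost everywhere and updates preserve null sets, so the gradient may be
computed from any measurable representative. -/
lemma grad_ae_eq [IsProbabilityMeasure P] (hX : IsRademacherSeq P p X) {F : Ω → ℝ}
    {g : (ℕ → ℝ) → ℝ} (hg : Measurable g) (hFg : F =ᵐ[P] fun ω => g (fun k => X k ω)) :
    ∀ᵐ ω ∂P, ∀ k, grad P p X F k ω = discreteGrad p k g (fun j => X j ω) :=
  hX.ae_of_ae_seqLaw (hX.isRademacherLaw.discreteGrad_congr (representative_ae_eq hX hg hFg))

lemma memLp_representative (hX : IsRademacherSeq P p X) {F : Ω → ℝ} (hF : MemL2 P X F) :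
    MemLp (representative P X F) 2 (seqLaw P X) := by
  obtain ⟨h1, h2⟩ := representative_spec hF.2
  refine (memLp_map_measure_iff h1.aestronglyMeasurable hX.measurable_seq.aemeasurable).2 ?_
  exact (memLp_congr_ae h2).1 hF.1

lemma integral_seqLaw (hX : IsRademacherSeq P p X) {f : (ℕ → ℝ) → ℝ}
    (hf : AEStronglyMeasurable f (seqLaw P X)) :
    ∫ x, f x ∂(seqLaw P X) = ∫ ω, f (fun k => X k ω) ∂P :=
  integral_map hX.measurable_seq.aemeasurable hf

lemma pairingIntegrable_of_seqLaw (hX : IsRademacherSeq P p X) {a b : ℕ → Ω → ℝ}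
    {α β : ℕ → (ℕ → ℝ) → ℝ} (ha : ∀ᵐ ω ∂P, ∀ k, a k ω = α k fun j => X j ω)
    (hb : ∀ᵐ ω ∂P, ∀ k, b k ω = β k fun j => X j ω)
    (hs : ∀ᵐ x ∂(seqLaw P X), Summable fun k => α k x * β k x)
    (hi : Integrable (fun x => ∑' k, α k x * β k x) (seqLaw P X)) :
    PairingIntegrable P a b ∧
      pairing a b =ᵐ[P] (fun ω => ∑' k, α k (fun j => X j ω) * β k fun j => X j ω) ∧
      ∫ ω, pairing a b ω ∂P = ∫ x, ∑' k, α k x * β k x ∂(seqLaw P X) := by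
  have e : pairing a b =ᵐ[P] fun ω => ∑' k, α k (fun j => X j ω) * β k fun j => X j ω := by
    filter_upwards [ha, hb] with ω h1 h2
    exact tsum_congr fun k => by rw [h1 k, h2 k]
  refine ⟨⟨?_, ?_⟩, e, ?_⟩
  · filter_upwards [ha, hb, hX.ae_of_ae_seqLaw hs] with ω h1 h2 h3
    exact h3.congr fun k => by rw [h1 k, h2 k]
  · exact (hX.measurePreserving.integrable_comp_of_integrable hi).congr e.symm
  · rw [integral_congr_ae e, integral_seqLaw hX hi.1]

lemma summable_integral_sq_iff {α : Type*} [MeasurableSpace α] {ν : Measure α} {u : ℕ → α → ℝ}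
    (hu : ∀ k, MemLp (u k) 2 ν) :
    ∫⁻ x, ∑' k, ENNReal.ofReal (u k x ^ 2) ∂ν < ∞ ↔ Summable fun k => ∫ x, u k x ^ 2 ∂ν := by
  rw [lintegral_tsum fun k => ((hu k).1.aemeasurable.pow_const 2).ennreal_ofReal]
  have e : ∀ k, ∫⁻ x, ENNReal.ofReal (u k x ^ 2) ∂ν = ENNReal.ofReal (∫ x, u k x ^ 2 ∂ν) :=
    fun k => (ofReal_integral_eq_lintegral_ofReal (hu k).integrable_sq
      (Eventually.of_forall fun _ => sq_nonneg _)).symm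
  simp only [e]
  refine ⟨fun h => ?_, fun h => h.tsum_ofReal_lt_top⟩
  refine (ENNReal.summable_toReal h.ne).congr fun k => ?_
  rw [ENNReal.toReal_ofReal (integral_nonneg fun _ => sq_nonneg _)]

lemma memLp_grad [IsProbabilityMeasure P] (hX : IsRademacherSeq P p X) {F : Ω → ℝ}
    (hF : MemL2 P X F) (k : ℕ) : MemLp (grad P p X F k) 2 P :=
  (hX.isRademacherLaw.memLp_discreteGrad k (memLp_representative hX hF)).comp_measurePreserving
    hX.measurePreserving

lemma integral_grad_sq [IsProbabilityMeasure P] (hX : IsRademacherSeq P p X) {F : Ω → ℝ}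
    (hF : MemL2 P X F) (k : ℕ) : ∫ ω, grad P p X F k ω ^ 2 ∂P =
      ∫ x, discreteGrad p k (representative P X F) x ^ 2 ∂(seqLaw P X) :=
  (integral_seqLaw hX (hX.isRademacherLaw.memLp_discreteGrad k
    (memLp_representative hX hF)).integrable_sq.1).symm

lemma memD12_iff [IsProbabilityMeasure P] (hX : IsRademacherSeq P p X) {F : Ω → ℝ} :
    MemD12 P p X F ↔ MemL2 P X F ∧ Summable fun k =>
      ∫ x, discreteGrad p k (representative P X F) x ^ 2 ∂(seqLaw P X) := by
  refine and_congr_right fun hF => ?_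
  rw [summable_integral_sq_iff (memLp_grad hX hF)]
  simp only [integral_grad_sq hX hF]

end Transfer

end Rademacher
end

noncomputable section

namespace Rademacher

section ChaosTransfer

variable {Ω : Type*} [MeasurableSpace Ω] {P : Measure Ω} {p : ℕ → ℝ} {X : ℕ → Ω → ℝ}

/-! ### Chaos expansions -/

/-- Composition with the sequence, as an isometry of `L²` spaces. -/
def IsRademacherSeq.compLp (hX : IsRademacherSeq P p X) :
    Lp ℝ 2 (seqLaw P X) →ₗᵢ[ℝ] Lp ℝ 2 P :=
  Lp.compMeasurePreservingₗᵢ ℝ _ hX.measurePreserving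

lemma IsRademacherSeq.coeFn_compLp (hX : IsRademacherSeq P p X) (g : Lp ℝ 2 (seqLaw P X)) :
    hX.compLp g =ᵐ[P] fun ω => g fun k => X k ω :=
  Lp.coeFn_compMeasurePreserving g hX.measurePreserving

lemma toL2_eq (hX : IsRademacherSeq P p X) {F : Ω → ℝ} {f : (ℕ → ℝ) → ℝ}
    (hf : MemLp f 2 (seqLaw P X)) (hFf : F =ᵐ[P] fun ω => f fun k => X k ω) :
    toL2 P F = hX.compLp hf.toLp := by
  have hF : MemLp F 2 P := (memLp_congr_ae hFf).2 (hf.comp_measurePreserving hX.measurePreserving)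
  rw [toL2, dif_pos hF]
  refine Lp.ext ?_
  filter_upwards [hF.coeFn_toLp, hX.coeFn_compLp hf.toLp, hFf,
    hX.ae_of_ae_seqLaw hf.coeFn_toLp] with ω h1 h2 h3 h4
  rw [h1, h2, h3, h4]

variable [IsProbabilityMeasure P]

/-- For distinct indices the product of the Y_{i_j} is the Walsh function of the set of indices. -/
lemma multInt_eq (hX : IsRademacherSeq P p X) [IsProbabilityMeasure (seqLaw P X)] {n : ℕ}
    {f : (Fin n → ℕ) → ℝ} (hf : Summable fun i => f i ^ 2) :
    multInt P p X n f = hX.compLp (chaosSum hX.isRademacherLaw.walshLp f) := by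
  have hs := summable_chaosTerm hX.isRademacherLaw.orthonormal_walshLp hf
  rw [chaosSum, ← LinearIsometry.coe_toContinuousLinearMap, ContinuousLinearMap.map_tsum _ hs,
    multInt]
  refine tsum_congr fun i => ?_
  rw [chaosTerm]
  split_ifs with hi
  · have hW := hX.isRademacherLaw.memLp_walsh (tupleSet i) 2
    rw [toL2_eq hX (hW.const_mul (f i))]
    · rfl
    · refine Eventually.of_forall fun ω => ?_
      dsimp only
      congr 1
      rw [walsh, tupleSet, Finset.prod_image fun a _ b _ h => hi h]
      rfl
  · simp

lemma exists_isChaosExpansion (hX : IsRademacherSeq P p X) {F : Ω → ℝ} (hF : MemL2 P X F)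
    (hmean : ∫ ω, F ω ∂P = 0) : ∃ f, IsChaosExpansion P p X F f := by
  have := hX.isProbabilityMeasure_seqLaw
  have hf := memLp_representative hX hF
  have h := hX.isRademacherLaw
  obtain ⟨hm, hFf⟩ := representative_spec hF.2
  obtain ⟨c, hc, hsum⟩ := exists_hasSum_chaosSum h.walshBasis hf.toLp
  have he := h.walshBasis.orthonormal
  refine ⟨c, fun n _ => hc n, ?_⟩
  simp only [hmean, sub_zero]
  rw [toL2_eq hX hf hFf]
  simp only [fun n : ℕ => multInt_eq hX (hc (n + 1)).1]
  -- The order-zero part is the mean of F, so the expansion may start at order one.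
  have h0 : chaosSum h.walshBasis (c 0) = 0 := by
    refine eq_of_forall_inner_eq h.walshBasis fun A => ?_
    rw [inner_zero_right]
    by_cases hA : A.card = 0
    · have h1 := hsum.mapL (innerSL ℝ (h.walshBasis A))
      have h2 := h1.unique (hasSum_single 0 fun n hn =>
        inner_chaosSum_of_card_ne he (hc n).1 (by omega))
      simp only [innerSL_apply_apply] at h2
      refine h2.symm.trans ?_
      rw [Finset.card_eq_zero.1 hA, h.coe_walshBasis, real_inner_comm,
        h.inner_toLp_walshLp]
      simp only [walshCoef, walsh_empty, mul_one]
      rw [integral_seqLaw hX hf.1, ← integral_congr_ae hFf, hmean]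
    · exact inner_chaosSum_of_card_ne he (hc 0).1 hA
  have h1 : HasSum (fun n => chaosSum h.walshBasis (c (n + 1))) hf.toLp := by
    rw [hasSum_nat_add_iff (f := fun n => chaosSum h.walshBasis (c n)) 1]
    simpa [h0] using hsum
  rw [h.coe_walshBasis] at h1
  exact h1.mapL hX.compLp.toContinuousLinearMap

/-- The Walsh coefficients of `L⁻¹ F`. -/
lemma exists_invOU_eq (hX : IsRademacherSeq P p X) {F : Ω → ℝ} (hF : MemL2 P X F)
    (hmean : ∫ ω, F ω ∂P = 0) : ∃ L : (ℕ → ℝ) → ℝ, Measurable L ∧ MemLp L 2 (seqLaw P X) ∧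
      (invOU P p X F =ᵐ[P] fun ω => L fun k => X k ω) ∧
      ∀ A : Finset ℕ, walshCoef (seqLaw P X) p L A =
        -(walshCoef (seqLaw P X) p (representative P X F) A / A.card) := by
  have := hX.isProbabilityMeasure_seqLaw
  have hf := memLp_representative hX hF
  have h := hX.isRademacherLaw
  obtain ⟨hm, hFf⟩ := representative_spec hF.2
  have hex := exists_isChaosExpansion hX hF hmean
  have hspec : IsChaosExpansion P p X F (chaosKernel P p X F) := by
    rw [chaosKernel, dif_pos hex]
    exact hex.choose_spec
  set c := chaosKernel P p X F with hc
  obtain ⟨hker, hsum⟩ := hspec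
  have hmul : ∀ n : ℕ, multInt P p X (n + 1) (c (n + 1)) =
      hX.compLp (chaosSum h.walshBasis (c (n + 1))) := fun n => by
    rw [multInt_eq hX (hker (n + 1) n.succ_pos).1, h.coe_walshBasis]
  simp only [hmean, sub_zero, hmul] at hsum
  rw [toL2_eq hX hf hFf] at hsum
  -- An isometry reflects convergence, so the chosen expansion descends to the sequence space, where
  -- basis coefficients can be compared.
  have hsum' : HasSum (fun n => chaosSum h.walshBasis (c (n + 1))) hf.toLp :=
    (hX.compLp.isometry.isEmbedding.isInducing.hasSum_iff _ _).1 hsum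
  obtain ⟨hs, hin⟩ := summable_and_inner_tsum_chaosSum h.walshBasis hker hsum'
  set w := ∑' n : ℕ, (-(1 / ((n : ℝ) + 1))) • chaosSum h.walshBasis (c (n + 1))
  refine ⟨w, (Lp.stronglyMeasurable w).measurable, Lp.memLp w, ?_, fun A => ?_⟩
  · have e : invOU P p X F = hX.compLp w := by
      rw [invOU, ← LinearIsometry.coe_toContinuousLinearMap, ContinuousLinearMap.map_tsum _ hs]
      refine tsum_congr fun n => ?_
      rw [← hc, hmul, map_smul]
      rfl
    rw [e]
    exact hX.coeFn_compLp w
  · rw [← h.inner_toLp_walshLp (Lp.memLp w), Lp.toLp_coeFn, real_inner_comm, ← h.coe_walshBasis,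
      hin, h.coe_walshBasis, real_inner_comm, h.inner_toLp_walshLp]

/-! ### Existence of the divergence -/

end ChaosTransfer

namespace IsRademacherLaw

variable {μ : Measure (ℕ → ℝ)} {p : ℕ → ℝ}

lemma discreteGrad_coeFn_add (h : IsRademacherLaw μ p) (f g : Lp ℝ 2 μ) :
    ∀ᵐ x ∂μ, ∀ k, discreteGrad p k (f + g : Lp ℝ 2 μ) x =
      discreteGrad p k f x + discreteGrad p k g x := by
  filter_upwards [h.discreteGrad_congr (Lp.coeFn_add f g)] with x hx k
  rw [hx k, discreteGrad, discreteGrad, discreteGrad, Pi.add_apply, Pi.add_apply]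
  ring

lemma discreteGrad_coeFn_smul (h : IsRademacherLaw μ p) (c : ℝ) (f : Lp ℝ 2 μ) :
    ∀ᵐ x ∂μ, ∀ k, discreteGrad p k (c • f : Lp ℝ 2 μ) x = c * discreteGrad p k f x := by
  filter_upwards [h.discreteGrad_congr (Lp.coeFn_smul c f)] with x hx k
  rw [hx k, discreteGrad, discreteGrad, Pi.smul_apply, Pi.smul_apply, smul_eq_mul, smul_eq_mul]
  ring

/-- The Sobolev-type space `𝔻^{1,2}` as a subspace of `L²`. -/
def sobolev (h : IsRademacherLaw μ p) : Submodule ℝ (Lp ℝ 2 μ) where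
  carrier := {f | Summable fun k => ∫ x, discreteGrad p k f x ^ 2 ∂μ}
  zero_mem' := by
    refine summable_zero.congr fun k => ?_
    symm
    refine integral_eq_zero_of_ae ?_
    filter_upwards [h.discreteGrad_congr (Lp.coeFn_zero ℝ 2 μ)] with x hx
    rw [hx k]; simp [discreteGrad]
  add_mem' := fun {f g} hf hg => by
    have mf := fun k => (h.memLp_discreteGrad k (Lp.memLp f)).integrable_sq
    have mg := fun k => (h.memLp_discreteGrad k (Lp.memLp g)).integrable_sq
    refine Summable.of_nonneg_of_le (fun _ => integral_nonneg fun _ => sq_nonneg _) (fun k => ?_)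
      ((hf.mul_left 2).add (hg.mul_left 2))
    rw [← integral_const_mul, ← integral_const_mul,
      ← integral_add ((mf k).const_mul 2) ((mg k).const_mul 2)]
    refine integral_mono_ae (h.memLp_discreteGrad k (Lp.memLp _)).integrable_sq
      (((mf k).const_mul 2).add ((mg k).const_mul 2)) ?_
    filter_upwards [h.discreteGrad_coeFn_add f g] with x hx
    rw [hx k]
    nlinarith [sq_nonneg (discreteGrad p k f x - discreteGrad p k g x)]
  smul_mem' := fun c f hf => by
    refine (hf.mul_left (c ^ 2)).congr fun k => ?_
    rw [← integral_const_mul]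
    refine integral_congr_ae ?_
    filter_upwards [h.discreteGrad_coeFn_smul c f] with x hx
    rw [hx k]; ring

lemma mem_sobolev (h : IsRademacherLaw μ p) {f : Lp ℝ 2 μ} :
    f ∈ h.sobolev ↔ Summable fun k => ∫ x, discreteGrad p k f x ^ 2 ∂μ := Iff.rfl

lemma ae_summable_discreteGrad_mul (h : IsRademacherLaw μ p) {U : ℕ → (ℕ → ℝ) → ℝ}
    (hU : ∀ k, MemLp (U k) 2 μ) (hUs : Summable fun k => ∫ x, U k x ^ 2 ∂μ) {f : (ℕ → ℝ) → ℝ}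
    (hf : MemLp f 2 μ) (hfs : Summable fun k => ∫ x, discreteGrad p k f x ^ 2 ∂μ) :
    (∀ᵐ x ∂μ, Summable fun k => discreteGrad p k f x * U k x) ∧
      Integrable (fun x => ∑' k, discreteGrad p k f x * U k x) μ :=
  ae_summable_and_integrable_tsum
    (fun k => (h.memLp_discreteGrad k hf).integrable_mul (hU k))
    (summable_integral_abs_mul (fun k => h.memLp_discreteGrad k hf) hU hfs hUs)

/-- The linear functional `f ↦ E⟨Df, U⟩` on `𝔻^{1,2}`. -/
def pairingFunctional (h : IsRademacherLaw μ p) {U : ℕ → (ℕ → ℝ) → ℝ}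
    (hU : ∀ k, MemLp (U k) 2 μ) (hUs : Summable fun k => ∫ x, U k x ^ 2 ∂μ) :
    h.sobolev →ₗ[ℝ] ℝ where
  toFun f := ∫ x, ∑' k, discreteGrad p k (f : Lp ℝ 2 μ) x * U k x ∂μ
  map_add' f g := by
    obtain ⟨s1, i1⟩ := h.ae_summable_discreteGrad_mul hU hUs (Lp.memLp f.1) (h.mem_sobolev.1 f.2)
    obtain ⟨s2, i2⟩ := h.ae_summable_discreteGrad_mul hU hUs (Lp.memLp g.1) (h.mem_sobolev.1 g.2)
    rw [← integral_add i1 i2]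
    refine integral_congr_ae ?_
    filter_upwards [s1, s2, h.discreteGrad_coeFn_add f.1 g.1] with x h1 h2 hx
    rw [← h1.tsum_add h2]
    refine tsum_congr fun k => ?_
    rw [Submodule.coe_add, hx k]; ring
  map_smul' c f := by
    rw [RingHom.id_apply, smul_eq_mul, ← integral_const_mul]
    refine integral_congr_ae ?_
    filter_upwards [h.discreteGrad_coeFn_smul c f.1] with x hx
    rw [← tsum_mul_left]
    refine tsum_congr fun k => ?_
    rw [Submodule.coe_smul, hx k]; ring

/-- Hahn-Banach extends the bounded functional f ↦ E⟨Df, U⟩ from 𝔻^{1,2} to L², and the Riesz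
representation theorem yields d. -/
lemma exists_divergence (h : IsRademacherLaw μ p) {U : ℕ → (ℕ → ℝ) → ℝ}
    (hU : ∀ k, MemLp (U k) 2 μ) (hUs : Summable fun k => ∫ x, U k x ^ 2 ∂μ) {C : ℝ}
    (hC : ∀ f : Lp ℝ 2 μ, f ∈ h.sobolev →
      |∫ x, ∑' k, discreteGrad p k f x * U k x ∂μ| ≤ C * ‖f‖) :
    ∃ d : Lp ℝ 2 μ, ∀ f : (ℕ → ℝ) → ℝ, MemLp f 2 μ →
      (Summable fun k => ∫ x, discreteGrad p k f x ^ 2 ∂μ) →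
      ∫ x, ∑' k, discreteGrad p k f x * U k x ∂μ = ∫ x, f x * d x ∂μ := by
  obtain ⟨ℓ, hℓ, -⟩ := exists_extension_norm_eq h.sobolev
    ((h.pairingFunctional hU hUs).mkContinuous C fun f => hC f.1 f.2)
  refine ⟨(InnerProductSpace.toDual ℝ (Lp ℝ 2 μ)).symm ℓ, fun f hf hfs => ?_⟩
  have hcongr := h.discreteGrad_congr hf.coeFn_toLp
  have hmem : hf.toLp ∈ h.sobolev := by
    refine h.mem_sobolev.2 (hfs.congr fun k => integral_congr_ae ?_)
    filter_upwards [hcongr] with x hx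
    rw [hx k]
  have h1 : ℓ hf.toLp = ∫ x, ∑' k, discreteGrad p k hf.toLp x * U k x ∂μ := hℓ ⟨_, hmem⟩
  have h2 : ∫ x, ∑' k, discreteGrad p k f x * U k x ∂μ = ℓ hf.toLp := by
    rw [h1]
    refine integral_congr_ae ?_
    filter_upwards [hcongr] with x hx
    exact tsum_congr fun k => by rw [hx k]
  rw [h2, ← InnerProductSpace.toDual_symm_apply, L2.inner_def]
  refine integral_congr_ae ?_
  filter_upwards [hf.coeFn_toLp] with x hx
  rw [hx]; rfl

end IsRademacherLaw

section Divergence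

variable {Ω : Type*} [MeasurableSpace Ω] {P : Measure Ω} [IsProbabilityMeasure P]
  {p : ℕ → ℝ} {X : ℕ → Ω → ℝ}

lemma memLp_of_lintegral_tsum_sq_lt_top {α : Type*} [MeasurableSpace α] {ν : Measure α}
    {u : ℕ → α → ℝ} (hu : ∀ k, AEStronglyMeasurable (u k) ν)
    (h : ∫⁻ x, ∑' k, ENNReal.ofReal (u k x ^ 2) ∂ν < ∞) (k : ℕ) : MemLp (u k) 2 ν := by
  rw [memLp_two_iff_integrable_sq (hu k)]
  refine ⟨(hu k).pow 2, lt_of_le_of_lt (lintegral_mono fun x => ?_) h⟩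
  dsimp only
  rw [Real.enorm_eq_ofReal (sq_nonneg _)]
  exact ENNReal.le_tsum (f := fun k => ENNReal.ofReal (u k x ^ 2)) k

lemma exists_isDiv (hX : IsRademacherSeq P p X) {U : ℕ → (ℕ → ℝ) → ℝ}
    (hU : ∀ k, Measurable (U k)) (hdom : DomDiv P p X fun k ω => U k fun j => X j ω) :
    ∃ d, IsDiv P p X (fun k ω => U k fun j => X j ω) d := by
  have := hX.isProbabilityMeasure_seqLaw
  have h := hX.isRademacherLaw
  obtain ⟨⟨-, hfin⟩, C, hC0, hC⟩ := hdom
  have mu := memLp_of_lintegral_tsum_sq_lt_top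
    (fun k => ((hU k).comp hX.measurable_seq).aestronglyMeasurable) hfin
  have mU : ∀ k, MemLp (U k) 2 (seqLaw P X) := fun k =>
    (memLp_map_measure_iff (hU k).aestronglyMeasurable hX.measurable_seq.aemeasurable).2 (mu k)
  have hUs : Summable fun k => ∫ x, U k x ^ 2 ∂(seqLaw P X) := by
    refine ((summable_integral_sq_iff mu).1 hfin).congr fun k => ?_
    exact (integral_seqLaw hX (mU k).integrable_sq.1).symm
  have key : ∀ (F : Ω → ℝ) (f : (ℕ → ℝ) → ℝ), Measurable f → MemLp f 2 (seqLaw P X) →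
      (Summable fun k => ∫ x, discreteGrad p k f x ^ 2 ∂(seqLaw P X)) →
      (F =ᵐ[P] fun ω => f fun k => X k ω) →
      ∫ ω, pairing (grad P p X F) (fun k ω => U k fun j => X j ω) ω ∂P =
        ∫ x, ∑' k, discreteGrad p k f x * U k x ∂(seqLaw P X) := fun F f hm hf hfs hFf => by
    obtain ⟨s, i⟩ := h.ae_summable_discreteGrad_mul mU hUs hf hfs
    exact (pairingIntegrable_of_seqLaw hX (grad_ae_eq hX hm hFf)
      (Eventually.of_forall fun ω k => rfl) s i).2.2
  obtain ⟨d, hd⟩ := h.exists_divergence mU hUs (C := C) fun f hf => by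
    have hm : Measurable f := (Lp.stronglyMeasurable f).measurable
    have hf2 := Lp.memLp f
    rw [← key (fun ω => f fun k => X k ω) f hm hf2 (h.mem_sobolev.1 hf) .rfl]
    have hL2 : MemL2 P X (fun ω => f fun k => X k ω) :=
      ⟨hf2.comp_measurePreserving hX.measurePreserving, aestronglyMeasurable_comp_seq hm⟩
    have hD : MemD12 P p X (fun ω => f fun k => X k ω) := by
      refine (memD12_iff hX).2 ⟨hL2, (h.mem_sobolev.1 hf).congr fun k => integral_congr_ae ?_⟩
      filter_upwards [h.discreteGrad_congr (representative_ae_eq hX hm (F := fun ω =>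
        f fun k => X k ω) .rfl)] with x hx
      rw [hx k]
    refine (hC _ hD).trans_eq ?_
    congr 1
    rw [← integral_seqLaw hX hf2.integrable_sq.1, Real.sqrt_eq_iff_mul_self_eq
      (integral_nonneg fun _ => sq_nonneg _) (norm_nonneg _), ← real_inner_self_eq_norm_mul_norm,
      L2.inner_def]
    refine integral_congr_ae (Eventually.of_forall fun x => ?_)
    simp [sq]
  have hdm : Measurable d := (Lp.stronglyMeasurable d).measurable
  refine ⟨fun ω => d fun k => X k ω, ⟨(Lp.memLp d).comp_measurePreserving hX.measurePreserving,
    aestronglyMeasurable_comp_seq hdm⟩, fun F hF => ?_⟩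
  obtain ⟨hL2, hs⟩ := (memD12_iff hX).1 hF
  obtain ⟨hm, hFf⟩ := representative_spec hL2.2
  have hf := memLp_representative hX hL2
  rw [key F _ hm hf hs hFf, hd _ hf hs]
  refine (integral_seqLaw hX (hf.integrable_mul (Lp.memLp d)).1).trans (integral_congr_ae ?_)
  filter_upwards [hFf] with ω hω
  rw [Pi.mul_apply, ← hω]

end Divergence

end Rademacher
end

noncomputable section

namespace Rademacher

/-! ## The Kolmogorov bounds -/

section Main

lemma steinFunctional_eq {Ω : Type*} (z : ℝ) (F : Ω → ℝ) (ω : Ω) :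
    steinFunctional z F ω = steinMono z (F ω) := by
  simp [steinFunctional, steinMono, Set.indicator_apply]

variable {Ω : Type*} [MeasurableSpace Ω] {P : Measure Ω} {p : ℕ → ℝ} {X : ℕ → Ω → ℝ}

lemma IsRademacherSeq.pq_pos (hX : IsRademacherSeq P p X) (k : ℕ) : 0 < pq p k :=
  mul_pos (hX.mem_Ioo k).1 (sub_pos.2 (hX.mem_Ioo k).2)

lemma kolmogorovDist_map_le {F : Ω → ℝ} (hF : AEMeasurable F P) {c : ℝ}
    (h : ∀ z, |P.real {ω | F ω ≤ z} - stdNormalCDF z| ≤ c) :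
    kolmogorovDist (P.map F) (gaussianReal 0 1) ≤ c := by
  refine ciSup_le fun z => ?_
  rw [map_measureReal_apply_of_aemeasurable hF measurableSet_Iic, ← cdf_eq_real]
  exact h z

variable [IsProbabilityMeasure P]

lemma pairing_invOU_and_kolmogorov (hX : IsRademacherSeq P p X) {F : Ω → ℝ}
    (hF : MemD12 P p X F) (hmean : ∫ ω, F ω ∂P = 0) :
    PairingIntegrable P (grad P p X F) (fun k ω => -gradInvOU P p X F k ω) ∧
    (∀ z : ℝ, PairingIntegrable P (steinGradTerm P p X F z)
      (fun k ω => |gradInvOU P p X F k ω|)) ∧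
    (∀ z : ℝ, ∫ ω, pairing (steinGradTerm P p X F z) (fun k ω' => |gradInvOU P p X F k ω'|) ω ∂P ≤
      2 * ∑' k, ∫ ω, grad P p X F k ω ^ 2 ∂P) ∧
    ∀ z : ℝ, |P.real {ω | F ω ≤ z} - stdNormalCDF z| ≤ firstTerm P p X F +
      ∫ ω, pairing (steinGradTerm P p X F z) (fun k ω' => |gradInvOU P p X F k ω'|) ω ∂P := by
  have := hX.isProbabilityMeasure_seqLaw
  have h := hX.isRademacherLaw
  obtain ⟨hL2, hs⟩ := (memD12_iff hX).1 hF
  obtain ⟨hm, hFf⟩ := representative_spec hL2.2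
  have hf := memLp_representative hX hL2
  obtain ⟨L, hLm, hL, hinv, hcoef⟩ := exists_invOU_eq hX hL2 hmean
  set f := representative P X F
  have h0 : ∫ x, f x ∂(seqLaw P X) = 0 := by
    rw [integral_seqLaw hX hf.1, ← integral_congr_ae hFf, hmean]
  have hgL : ∀ᵐ ω ∂P, ∀ k, gradInvOU P p X F k ω = discreteGrad p k L fun j => X j ω :=
    grad_ae_eq hX hLm hinv
  have hgL' : ∀ᵐ ω ∂P, ∀ k, -gradInvOU P p X F k ω = -discreteGrad p k L fun j => X j ω :=
    hgL.mono fun ω hω k => by rw [hω k]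
  have hgLabs : ∀ᵐ ω ∂P, ∀ k, |gradInvOU P p X F k ω| = |discreteGrad p k L fun j => X j ω| :=
    hgL.mono fun ω hω k => by rw [hω k]
  have hst : ∀ z, ∀ᵐ ω ∂P, ∀ k, steinGradTerm P p X F z k ω =
      discreteGrad p k (fun y => steinMono z (f y)) (fun j => X j ω) *
        (discreteGrad p k f (fun j => X j ω) / √(pq p k)) := fun z => by
    have h1 : steinFunctional z F =ᵐ[P] fun ω => steinMono z (f fun k => X k ω) := by
      filter_upwards [hFf] with ω hω
      rw [steinFunctional_eq, ← hω]
    filter_upwards [grad_ae_eq hX ((IsRademacherLaw.measurable_steinMono z).comp hm) h1]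
      with ω hω k
    rw [steinGradTerm, hω k]; rfl
  obtain ⟨s0, i0⟩ := h.integrable_pairing_invOU hf hL hcoef hs hf hs
  have T0 := pairingIntegrable_of_seqLaw hX (a := grad P p X F)
    (Eventually.of_forall fun ω k => grad_eq F k ω) hgL' s0 i0
  have T1 : ∀ z, _ := fun z =>
    have hp := h.steinMono_pairing hm hf hL hcoef hs z
    pairingIntegrable_of_seqLaw hX (hst z) hgLabs hp.1 hp.2.1
  refine ⟨T0.1, fun z => (T1 z).1, fun z => ?_, fun z => ?_⟩
  · rw [(T1 z).2.2]
    simp only [integral_grad_sq hX hL2]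
    exact (h.steinMono_pairing hm hf hL hcoef hs z).2.2
  · rw [(T1 z).2.2]
    have e1 : firstTerm P p X F = ∫ x, |1 - ∑' k, discreteGrad p k f x * -discreteGrad p k L x|
        ∂(seqLaw P X) := by
      refine Eq.trans (integral_congr_ae ?_)
        (integral_seqLaw hX (aestronglyMeasurable_const.sub i0.1).norm).symm
      filter_upwards [T0.2.1] with ω hω
      rw [hω]; rfl
    have e2 : P.real {ω | F ω ≤ z} = (seqLaw P X).real {x | f x ≤ z} := by
      rw [seqLaw, map_measureReal_apply hX.measurable_seq
        (show MeasurableSet {x | f x ≤ z} from hm measurableSet_Iic)]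
      refine measureReal_congr ?_
      filter_upwards [hFf] with ω hω
      exact propext (by
        change F ω ≤ z ↔ f (fun k => X k ω) ≤ z
        rw [hω])
    rw [e1, e2]
    exact h.abs_measureReal_sub_le hm hf hL hcoef hs h0 z

/-- Moving D_kF / √(p_k q_k) to the other side of the pairing turns it into ⟨D(F f_z(F) + 1_{F >
z}), u⟩. Duality and |`steinMono`| ≤ 2 conclude. -/
lemma integral_pairing_le_divergence (hX : IsRademacherSeq P p X) {F : Ω → ℝ} {z : ℝ}
    (hz : MemD12 P p X (steinFunctional z F)) (hinv : AEStronglyMeasurable[sigmaX X]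
      (invOU P p X F) P) (hFm : AEStronglyMeasurable[sigmaX X] F P)
    (hdom : DomDiv P p X (uSeq P p X F)) :
    ∫ ω, pairing (steinGradTerm P p X F z) (fun k ω' => |gradInvOU P p X F k ω'|) ω ∂P ≤
      2 * ∫ ω, |divergence P p X (uSeq P p X F) ω| ∂P := by
  have hex : ∃ d, IsDiv P p X (uSeq P p X F) d := by
    refine exists_isDiv hX (U := fun k x => (√(pq p k))⁻¹ *
      discreteGrad p k (representative P X F) x *
      |discreteGrad p k (representative P X (invOU P p X F)) x|) (fun k => ?_) hdom
    exact ((measurable_discreteGrad p k (representative_spec hFm).1).const_mul _).mul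
      (measurable_discreteGrad p k (representative_spec hinv).1).norm
  obtain ⟨hd, hdual⟩ : IsDiv P p X (uSeq P p X F) (divergence P p X (uSeq P p X F)) := by
    rw [divergence, dif_pos hex]
    exact hex.choose_spec
  have e : ∀ ω, pairing (steinGradTerm P p X F z) (fun k ω' => |gradInvOU P p X F k ω'|) ω =
      pairing (grad P p X (steinFunctional z F)) (uSeq P p X F) ω := fun ω => by
    refine tsum_congr fun k => ?_
    rw [steinGradTerm, uSeq]; ring
  simp only [e]
  rw [hdual _ hz, ← integral_const_mul]
  have hdi := hd.1.integrable (q := 2) (by norm_num)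
  refine integral_mono (hz.1.1.integrable_mul hd.1) (hdi.abs.const_mul 2) fun ω => ?_
  refine (le_abs_self _).trans ?_
  dsimp only
  rw [abs_mul, steinFunctional_eq]
  exact mul_le_mul_of_nonneg_right (abs_steinMono_le z _) (abs_nonneg _)

lemma grad_ae_eq_zero_of_dependsOnFirst (hX : IsRademacherSeq P p X) {F : Ω → ℝ} {m : ℕ}
    (h : DependsOnFirst P X m F) {k : ℕ} (hk : m ≤ k) : ∀ᵐ ω ∂P, grad P p X F k ω = 0 := by
  obtain ⟨g, hg, hFg⟩ := h
  have hm : Measurable fun x : ℕ → ℝ => g fun j : Fin m => x j :=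
    hg.comp (measurable_pi_iff.2 fun j => measurable_pi_apply _)
  filter_upwards [grad_ae_eq hX hm hFg] with ω hω
  have e : ∀ s : ℝ, (fun j : Fin m => Function.update (fun j => X j ω) k s j) =
      fun j : Fin m => X j ω := fun s => by
    funext j
    exact Function.update_of_ne (by have := j.2; omega) _ _
  rw [hω k, discreteGrad, e, e, sub_self, mul_zero]

/-- Common form of both cases of part (3): s carries the coordinates with nonzero gradient, and only
their weights p_k q_k enter κ. -/
lemma ofReal_kolmogorovDist_le (hX : IsRademacherSeq P p X) {F : Ω → ℝ}
    (hF : MemD12 P p X F) (hmean : ∫ ω, F ω ∂P = 0) (s : Set ℕ)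
    (hs : ∀ k ∉ s, ∀ᵐ ω ∂P, grad P p X F k ω = 0) {κ : ℝ}
    (hκ : ∑' k, s.indicator (fun k => ENNReal.ofReal (pq p k)) k = ENNReal.ofReal κ)
    (hκ0 : 0 ≤ κ) :
    ENNReal.ofReal (kolmogorovDist (P.map F) (gaussianReal 0 1)) ≤
      ENNReal.ofReal (firstTerm P p X F) +
        ENNReal.ofReal (4 * √κ) * fourthMomentSum P p X F ^ (1 / 2 : ℝ) := by
  obtain ⟨-, -, hle, hK⟩ := pairing_invOU_and_kolmogorov hX hF hmean
  have h1 : kolmogorovDist (P.map F) (gaussianReal 0 1) ≤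
      firstTerm P p X F + 2 * ∑' k, ∫ ω, grad P p X F k ω ^ 2 ∂P :=
    kolmogorovDist_map_le hF.1.1.1.aemeasurable fun z =>
      (hK z).trans (add_le_add le_rfl (hle z))
  refine (ENNReal.ofReal_le_ofReal h1).trans (ENNReal.ofReal_add_le.trans ?_)
  gcongr
  have mg := memLp_grad hX hF.1
  have hsum : Summable fun k => ∫ ω, grad P p X F k ω ^ 2 ∂P :=
    (summable_integral_sq_iff mg).1 hF.2
  have h2 := tsum_lintegral_sq_le (fun k => (mg k).1.aemeasurable) hX.pq_pos s fun k hk => by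
    refine (lintegral_congr_ae ?_).trans lintegral_zero
    filter_upwards [hs k hk] with ω hω
    rw [hω]; simp
  have e : ∀ k, ∫⁻ ω, ENNReal.ofReal (grad P p X F k ω ^ 2) ∂P =
      ENNReal.ofReal (∫ ω, grad P p X F k ω ^ 2 ∂P) := fun k =>
    (ofReal_integral_eq_lintegral_ofReal (mg k).integrable_sq
      (Eventually.of_forall fun _ => sq_nonneg _)).symm
  simp only [e] at h2
  rw [← ENNReal.ofReal_tsum_of_nonneg (fun k => integral_nonneg fun _ => sq_nonneg _) hsum,
    hκ, ENNReal.ofReal_rpow_of_nonneg hκ0 (by norm_num), ← Real.sqrt_eq_rpow] at h2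
  rw [ENNReal.ofReal_mul (by norm_num)]
  calc _ ≤ ENNReal.ofReal 2 * (ENNReal.ofReal √κ * fourthMomentSum P p X F ^ (1 / 2 : ℝ)) := by
        gcongr; exact h2
    -- The argument yields the constant 2, relaxed here to 4.
    _ ≤ _ := by
        rw [← mul_assoc, ← ENNReal.ofReal_mul (by norm_num)]
        gcongr
        norm_num

end Main

end Rademacher

end

/-! ### The main theorem -/

open Rademacher
theorem theorem3p1 {Ω : Type*} [MeasurableSpace Ω] (P : Measure Ω) [IsProbabilityMeasure P]
    (p : ℕ → ℝ) (X : ℕ → Ω → ℝ) (hX : IsRademacherSeq P p X)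
    (F : Ω → ℝ) (hF : MemD12 P p X F)
    (hmean : ∫ ω, F ω ∂P = 0) (hvar : variance F P = 1) :
    -- the first term of the bounds is well defined
    PairingIntegrable P (grad P p X F) (fun k ω => -gradInvOU P p X F k ω) ∧
    -- part (1)
    ((∀ z : ℝ, MemD12 P p X (steinFunctional z F)) →
      (∀ z : ℝ, PairingIntegrable P (steinGradTerm P p X F z)
        (fun k ω => |gradInvOU P p X F k ω|)) ∧
      BddAbove (Set.range fun z : ℝ =>
        ∫ ω, pairing (steinGradTerm P p X F z) (fun k ω' => |gradInvOU P p X F k ω'|) ω ∂P) ∧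
      kolmogorovDist (P.map F) (gaussianReal 0 1) ≤
        firstTerm P p X F +
          ⨆ z : ℝ, ∫ ω, pairing (steinGradTerm P p X F z)
            (fun k ω' => |gradInvOU P p X F k ω'|) ω ∂P) ∧
    -- part (2)
    ((∀ z : ℝ, MemD12 P p X (steinFunctional z F)) → DomDiv P p X (uSeq P p X F) →
      kolmogorovDist (P.map F) (gaussianReal 0 1) ≤
        firstTerm P p X F + 2 * ∫ ω, |divergence P p X (uSeq P p X F) ω| ∂P) ∧
    -- part (3)
    ((∀ k, MemLp (grad P p X F k) 4 P) →
      -- case (a)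
      (Summable (pq p) →
        ENNReal.ofReal (kolmogorovDist (P.map F) (gaussianReal 0 1)) ≤
          ENNReal.ofReal (firstTerm P p X F) +
            ENNReal.ofReal (4 * √(∑' k, pq p k)) * fourthMomentSum P p X F ^ (1 / 2 : ℝ)) ∧
      -- case (b)
      (∀ m : ℕ, DependsOnFirst P X m F →
        ENNReal.ofReal (kolmogorovDist (P.map F) (gaussianReal 0 1)) ≤
          ENNReal.ofReal (firstTerm P p X F) +
            ENNReal.ofReal (4 * √(∑ k ∈ Finset.range m, pq p k)) *
              fourthMomentSum P p X F ^ (1 / 2 : ℝ))) := by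

  obtain ⟨hpair, hint, hle, hK⟩ := pairing_invOU_and_kolmogorov hX hF hmean
  have hFm := hF.1.1.1.aemeasurable
  have hbdd : BddAbove (Set.range fun z : ℝ =>
      ∫ ω, pairing (steinGradTerm P p X F z) (fun k ω' => |gradInvOU P p X F k ω'|) ω ∂P) :=
    ⟨_, Set.forall_mem_range.2 hle⟩
  refine ⟨hpair, fun _ => ⟨hint, hbdd, kolmogorovDist_map_le hFm fun z =>
    (hK z).trans (add_le_add le_rfl (le_ciSup hbdd z))⟩, fun hstar hdom => ?_, fun _ =>
    ⟨fun hsum => ?_, fun m hdep => ?_⟩⟩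
  · obtain ⟨L, hLm, -, hinv, -⟩ := exists_invOU_eq hX hF.1 hmean
    exact kolmogorovDist_map_le hFm fun z => (hK z).trans (add_le_add le_rfl
      (integral_pairing_le_divergence hX (hstar z)
        ((aestronglyMeasurable_comp_seq hLm).congr hinv.symm) hF.1.2 hdom))
  · refine ofReal_kolmogorovDist_le hX hF hmean Set.univ (fun k hk => absurd trivial hk) ?_
      (tsum_nonneg fun k => (hX.pq_pos k).le)
    rw [ENNReal.ofReal_tsum_of_nonneg (fun k => (hX.pq_pos k).le) hsum]
    simp
  -- Coordinates are numbered from 0, so the first m of them are `Finset.range m`.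
  · refine ofReal_kolmogorovDist_le hX hF hmean (Finset.range m) (fun k hk =>
      grad_ae_eq_zero_of_dependsOnFirst hX hdep (by simpa using hk)) ?_
      (Finset.sum_nonneg fun k _ => (hX.pq_pos k).le)
    rw [← sum_eq_tsum_indicator, ENNReal.ofReal_sum_of_nonneg fun k _ => (hX.pq_pos k).le]
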